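/- **Conventions.** The security parameter is $\kappa\in\mathbb N$. A function $f:\mathbb N\to\mathbb R$ is *negligible* if $\kappa^{d} f(\kappa)\to 0$ for every $d\in\mathbb N$. A *polynomially bounded adversary* is a probabilistic multi-tape (multi-stack) oracle Turing machine which gets $1^\kappa$ as input, outputs a bit, and halts within a number of steps polynomial in $\kappa$, whatever its coins and whatever the oracle answers (of the lengths that its oracles return). Let $n,s:\mathbb N\to\mathbb N$ be length functions that are computable in polynomial time ($1^\kappa\mapsto 1^{n(\kappa)}$, $1^\kappa\mapsto 1^{s(\kappa)}$), and suppose that $2^{-s(\kappa)}$ is negligible. Let $P$ be a strong pseudorandom permutation of block length $s+n$ with keys of length $s+n$: for every $k\in\{0,1\}^{s(\kappa)+n(\kappa)}$, $P_k$ is a permutation of $\{0,1\}^{s(\kappa)+n(\kappa)}$, and for every polynomially bounded adversary $\mathcal D$ $$\Bigl|\Pr_{k}\bigl[\mathcal D^{P_k,P_k^{-1}}(1^\kappa)=1\bigr]-\Pr_{\pi}\bigl[\mathcal D^{\pi,\pi^{-1}}(1^\kappa)=1\bigr]\Bigr|$$ is negligible, where $k$ is a uniform key and $\pi$ a uniform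 permutation of $\{0,1\}^{s(\kappa)+n(\kappa)}$. Let $\mathcal{SE}$ be the encryption scheme with message space $\{0,1\}^{n}$ and uniform keys $k\in\{0,1\}^{s+n}$ given by $$encrypt(k,m)=P_k(m\,\|\,u),\quad u \text{ a fresh uniform string in } \{0,1\}^{s},\qquad decrypt(k,c)=P_k^{-1}(c)[0:n].$$ **Theorem.** $\mathcal{SE}$ is CCA-secure, that is, for every polynomially bounded adversary $\mathcal A$, $\bigl|\Pr[\mathcal A \text{ wins}]-\tfrac12\bigr|$ is negligible in $\kappa$ for the following game. A uniform key $k$ and a uniform bit $b$ are drawn. $\mathcal A(1^\kappa)$ may query the oracles $encrypt(k,\cdot)$ and $decrypt(k,\cdot)$ throughout. Once, at a time of its choice, it submits two messages $m_0,m_1\in\{0,1\}^n$ and receives the challenge $c^*\leftarrow encrypt(k,m_b)$; from then on the decryption oracle refuses the query $c^*$. $\mathcal A$ outputs a bit $b'$ and wins if $b'=b$. -/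

import Mathlib

/-! ### Bit strings -/

/-- Bit strings of length `n`. -/
abbrev Bits (n : ℕ) : Type := Fin n → Bool

/-- The first `n` bits of a list, padded with zeros if the list is too short. Machines write words
of arbitrary length; this is how an oracle reads a word of the length that it expects. -/
def Bits.ofList (n : ℕ) (w : List Bool) : Bits n := fun i => w.getD i false

/-- The list of the bits of `x`, first bit first. -/
def Bits.toList {n : ℕ} (x : Bits n) : List Bool := List.ofFn x

/-- A function is negligible when it decays faster than every inverse polynomial. -/
def Negligible (f : ℕ → ℝ) : Prop :=
  Asymptotics.SuperpolynomialDecay Filter.atTop (fun κ : ℕ => (κ : ℝ)) f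

/-! ### Probabilistic oracle Turing machines -/

/-- The instructions of a probabilistic multi-stack machine with control states `Q`, stacks indexed
by `R` and oracles indexed by `τ`. Executing one instruction is one step. -/
inductive Instr (τ Q R : Type) : Type
  /-- stop -/
  | halt
  /-- push the bit `b` on stack `r`, go to `q` -/
  | push (r : R) (b : Bool) (q : Q)
  /-- remove the top bit of stack `r`; the next state depends on it (`none`: `r` was empty) -/
  | pop (r : R) (q : Option Bool → Q)
  /-- toss a fair coin; the next state depends on it -/
  | flip (q : Bool → Q)
  /-- ask oracle `t` about the word on stack `r` and replace that word by the answer, go to `q` -/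
  | query (t : τ) (r : R) (q : Q)

/-- A probabilistic multi-stack Turing machine (two stacks make up one tape) with access to oracles
indexed by `τ`. Its description is finite, so that it is a uniform algorithm. -/
structure OracleMachine (τ : Type) : Type 1 where
  /-- control states -/
  Q : Type
  /-- stacks -/
  R : Type
  [finiteQ : Finite Q]
  [finiteR : Finite R]
  [decR : DecidableEq R]
  start : Q
  inp : R
  out : R
  code : Q → Instr τ Q R

attribute [instance] OracleMachine.finiteQ OracleMachine.finiteR OracleMachine.decR

/-- A configuration: the control state and the contents of the stacks (top first). -/
structure OracleMachine.Cfg {τ : Type} (M : OracleMachine τ) : Type where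
  q : M.Q
  mem : M.R → List Bool

/-- The start configuration on the input `1^κ`. -/
def OracleMachine.init {τ : Type} (M : OracleMachine τ) (κ : ℕ) : M.Cfg :=
  ⟨M.start, Function.update (fun _ => []) M.inp (List.replicate κ true)⟩

/-- A family of oracles indexed by `τ` which may be randomized and share a state in `S`. -/
abbrev Oracle (τ S : Type) : Type := τ → List Bool → S → PMF (List Bool × S)

/-- One step in the presence of an oracle. Halted configurations stay as they are. -/
noncomputable def OracleMachine.step {τ S : Type} (M : OracleMachine τ) (O : Oracle τ S) :
    M.Cfg × S → PMF (M.Cfg × S)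
  | (c, σ) =>
    match M.code c.q with
    | .halt => PMF.pure (c, σ)
    | .push r b q => PMF.pure (⟨q, Function.update c.mem r (b :: c.mem r)⟩, σ)
    | .pop r q => PMF.pure (⟨q (c.mem r).head?, Function.update c.mem r (c.mem r).tail⟩, σ)
    | .flip q => (PMF.uniformOfFintype Bool).map fun b => (⟨q b, c.mem⟩, σ)
    | .query t r q => (O t (c.mem r) σ).map fun a => (⟨q, Function.update c.mem r a.1⟩, a.2)

/-- The distribution after `t` steps. -/
noncomputable def OracleMachine.run {τ S : Type} (M : OracleMachine τ) (O : Oracle τ S) :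
    ℕ → M.Cfg × S → PMF (M.Cfg × S)
  | 0, c => PMF.pure c
  | t + 1, c => (M.step O c).bind (M.run O t)

/-- Whatever the outcomes of the coins and whatever the oracles answer (in words of at most `ℓ`
bits), the machine halts after at most `t` steps, in a configuration that satisfies `post`. -/
def OracleMachine.HaltsWithin {τ : Type} (M : OracleMachine τ) (ℓ : ℕ) (post : M.Cfg → Prop) :
    ℕ → M.Cfg → Prop
  | 0, c => M.code c.q = .halt ∧ post c
  | t + 1, c =>
    match M.code c.q with
    | .halt => post c
    | .push r b q => M.HaltsWithin ℓ post t ⟨q, Function.update c.mem r (b :: c.mem r)⟩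
    | .pop r q =>
        M.HaltsWithin ℓ post t ⟨q (c.mem r).head?, Function.update c.mem r (c.mem r).tail⟩
    | .flip q => ∀ b, M.HaltsWithin ℓ post t ⟨q b, c.mem⟩
    | .query _ r q =>
        ∀ a : List Bool, a.length ≤ ℓ → M.HaltsWithin ℓ post t ⟨q, Function.update c.mem r a⟩

/-- `f` is a length function that can be computed in polynomial time, in the sense that a machine
without oracles computes `1^κ ↦ 1^(f κ)`. -/
def PolyTimeLength (f : ℕ → ℕ) : Prop :=
  ∃ (M : OracleMachine Empty) (p : Polynomial ℕ), ∀ κ,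
    M.HaltsWithin 0 (fun c => (c.mem M.out).length = f κ) (p.eval κ) (M.init κ)

/-- A polynomially bounded adversary: a probabilistic oracle machine that halts, on the security
parameter `1^κ`, within a number of steps polynomial in `κ`, for all coins and all oracle answers
of at most `ℓ κ` bits. -/
structure PolyAdversary (τ : Type) (ℓ : ℕ → ℕ) : Type 1 extends OracleMachine τ where
  time : Polynomial ℕ
  halts : ∀ κ, toOracleMachine.HaltsWithin (ℓ κ) (fun _ => True) (time.eval κ)
    (toOracleMachine.init κ)

/-- The output bit of the adversary on `1^κ` with oracle `O` in initial state `σ`: whether the top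
of the output stack is the bit `1` when the machine has halted. -/
noncomputable def PolyAdversary.output {τ : Type} {ℓ : ℕ → ℕ} {S : Type} (A : PolyAdversary τ ℓ)
    (κ : ℕ) (O : Oracle τ S) (σ : S) : PMF Bool :=
  (A.run O (A.time.eval κ) (A.init κ, σ)).map fun c => decide ((c.1.mem A.out).head? = some true)

/-! ### Strong pseudorandom permutations -/

/-- Keyed permutations: for every security parameter `κ` and every key of `N κ` bits a permutation
of the blocks of `N κ` bits. -/
abbrev KeyedPerm (N : ℕ → ℕ) : Type := ∀ κ, Bits (N κ) → Equiv.Perm (Bits (N κ))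

/-- The two oracles of a distinguisher: a permutation and its inverse. -/
inductive PermQuery : Type
  | fwd
  | inv

/-- Access to the permutation `π` and to its inverse. -/
noncomputable def permOracle {N : ℕ} (π : Equiv.Perm (Bits N)) : Oracle PermQuery Unit
  | .fwd, w, _ => PMF.pure (Bits.toList (π (Bits.ofList N w)), ())
  | .inv, w, _ => PMF.pure (Bits.toList (π.symm (Bits.ofList N w)), ())

/-- The distinguisher's output when it has access to `P_k` and its inverse, `k` a uniform key. -/
noncomputable def sprpReal {N : ℕ → ℕ} (P : KeyedPerm N) (D : PolyAdversary PermQuery N) (κ : ℕ) :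
    PMF Bool :=
  (PMF.uniformOfFintype (Bits (N κ))).bind fun k => D.output κ (permOracle (P κ k)) ()

/-- The distinguisher's output when it has access to a uniform permutation and its inverse. -/
noncomputable def sprpIdeal {N : ℕ → ℕ} (D : PolyAdversary PermQuery N) (κ : ℕ) : PMF Bool :=
  (PMF.uniformOfFintype (Equiv.Perm (Bits (N κ)))).bind fun π => D.output κ (permOracle π) ()

/-- `P` is a strong pseudorandom permutation: every polynomially bounded distinguisher has
negligible advantage. -/
def IsSPRP {N : ℕ → ℕ} (P : KeyedPerm N) : Prop :=
  ∀ D : PolyAdversary PermQuery N,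
    Negligible fun κ => |(sprpReal P D κ true).toReal - (sprpIdeal D κ true).toReal|

/-! ### Encryption schemes and CCA security -/

/-- A symmetric encryption scheme with uniform keys of `keyLen κ` bits, messages of `msgLen κ` bits
and ciphertexts of `ctLen κ` bits. -/
structure EncScheme (keyLen msgLen ctLen : ℕ → ℕ) : Type where
  encrypt : ∀ κ, Bits (keyLen κ) → Bits (msgLen κ) → PMF (Bits (ctLen κ))
  decrypt : ∀ κ, Bits (keyLen κ) → Bits (ctLen κ) → Bits (msgLen κ)
  correct : ∀ κ k m, ∀ c ∈ (encrypt κ k m).support, decrypt κ k c = m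

/-- The oracles of a chosen-ciphertext attacker: encryption, decryption, and the challenge. -/
inductive CCAQuery : Type
  | enc
  | dec
  | chal

/-- The oracles of the CCA indistinguishability game with key `k` and challenge bit `b`. The state
is the challenge ciphertext, once there is one. The challenge oracle reads two messages `m₀`, `m₁`
(written one after the other) and returns an encryption of `m_b`; it works only once. The
decryption oracle refuses the challenge ciphertext; a refusal is the empty word. -/
noncomputable def ccaOracle {keyLen msgLen ctLen : ℕ → ℕ} (E : EncScheme keyLen msgLen ctLen)
    (κ : ℕ) (k : Bits (keyLen κ)) (b : Bool) : Oracle CCAQuery (Option (Bits (ctLen κ)))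
  | .enc, w, σ =>
      (E.encrypt κ k (Bits.ofList (msgLen κ) w)).map fun c => (Bits.toList c, σ)
  | .dec, w, σ =>
      PMF.pure (if σ = some (Bits.ofList (ctLen κ) w) then []
        else Bits.toList (E.decrypt κ k (Bits.ofList (ctLen κ) w)), σ)
  | .chal, w, none =>
      (E.encrypt κ k
        (if b then Bits.ofList (msgLen κ) (w.drop (msgLen κ)) else Bits.ofList (msgLen κ) w)).map
        fun c => (Bits.toList c, some c)
  | .chal, _, some c => PMF.pure ([], some c)

/-- The CCA indistinguishability game: a uniform key and a uniform bit `b` are drawn, and the result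
is whether the adversary's output is `b`. -/
noncomputable def ccaGame {keyLen msgLen ctLen : ℕ → ℕ} (E : EncScheme keyLen msgLen ctLen)
    (A : PolyAdversary CCAQuery fun κ => max (msgLen κ) (ctLen κ)) (κ : ℕ) : PMF Bool :=
  (PMF.uniformOfFintype (Bits (keyLen κ))).bind fun k =>
    (PMF.uniformOfFintype Bool).bind fun b =>
      (A.output κ (ccaOracle E κ k b) none).map fun b' => b' == b

/-- CCA security: every polynomially bounded adversary has negligible advantage over guessing. -/
def IsCCASecure {keyLen msgLen ctLen : ℕ → ℕ} (E : EncScheme keyLen msgLen ctLen) : Prop :=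
  ∀ A : PolyAdversary CCAQuery fun κ => max (msgLen κ) (ctLen κ),
    Negligible fun κ => |(ccaGame E A κ true).toReal - 1 / 2|

/-! ### The scheme -/

/-- The scheme `SE`: keys and ciphertexts have `n + s` bits, messages have `n` bits. A message `m` is
encrypted as `P_k(m ‖ u)` for a fresh uniform salt `u` of `s` bits; decryption returns the first
`n` bits of `P_k⁻¹(c)`. -/
noncomputable def seScheme (n s : ℕ → ℕ) (P : KeyedPerm fun κ => n κ + s κ) :
    EncScheme (fun κ => n κ + s κ) n (fun κ => n κ + s κ) where
  encrypt κ k m := (PMF.uniformOfFintype (Bits (s κ))).map fun u => P κ k (Fin.append m u)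
  decrypt κ k c := fun i => (P κ k).symm c (Fin.castAdd (s κ) i)
  correct := by
    intro κ k m c hc
    obtain ⟨u, -, rfl⟩ := (PMF.mem_support_map_iff _ _ _).1 hc
    funext i
    simp

/-! The proof has two halves: a reduction to the game with a uniform permutation, and a statistical
bound for that game.

Reduction (`Reduction.exists_distinguisher`). A distinguisher draws the bit `b`, runs the attacker,
answers its queries through its own permutation and inverse, and reports whether the guess was
right. For every fixed permutation `π` its output has the law of the CCA game played with `π`. With
`π = P_k` this is the real game, so by the SPRP property the real game differs negligibly from the
game with a uniform `π`. The distinguisher must be an actual machine that halts in polynomial time.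
It is therefore written as a flowgraph, and `Block.Runs` records a time bound and the query tree
that the program realizes. Query trees forget the machine and keep only coins, queries and the final
bit; the simulation is correct at that level by `QueryTree.eval_simulate`, and `Reduction.acts_sim`
shows that the flowgraph realizes it.

Uniform permutation (`abs_random_game_sub_half_le`). Sums run over `permExtensions L`, the
permutations consistent with the pairs `L` revealed so far; splitting such a sum by the answer to a
query is conditioning on that answer. Before the challenge the games for the two bits are identical.
At the challenge put `x₀ = m₀ ‖ u` and `x₁ = m₁ ‖ u`. Unless one of them is already in `L`, which
happens for at most `|L|` salts, `π ↦ π ∘ (x₀ x₁)` permutes `permExtensions L` and turns the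
encryption of `m₁` into that of `m₀` (`abs_sum_outputProb_le`). It remains to tell `π` from `π ∘ (x₀
x₁)` after seeing `c₀ = π x₀` (`abs_sum_outputProb_swap_le`). They differ only at `x₀` and `x₁`. A
later encryption hits one of these for at most two salts; decryption of `c₀` is refused; and a
queried ciphertext is `π x₁` with probability at most `2 / 2 ^ s`, by
`card_permExtensions_cons_mul_le`. So every later query costs at most `2 / 2 ^ s`. -/

/-! ### Query trees -/

/-- The behaviour of a probabilistic oracle algorithm: coins, queries and a final bit. -/
inductive QueryTree (τ : Type) : Type
  | ret (x : Bool)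
  | flip (k : Bool → QueryTree τ)
  | query (t : τ) (w : List Bool) (k : List Bool → QueryTree τ)

/-- The distribution of the final bit when the queries are answered by `O`. -/
noncomputable def QueryTree.eval {τ S : Type} (O : Oracle τ S) : QueryTree τ → S → PMF Bool
  | ret x, _ => PMF.pure x
  | flip k, σ => (PMF.uniformOfFintype Bool).bind fun b => (k b).eval O σ
  | query t w k, σ => (O t w σ).bind fun a => (k a.1).eval O a.2

/-- The output bit of a configuration. -/
def OracleMachine.outBit {τ : Type} (M : OracleMachine τ) (m : M.R → List Bool) : Bool :=
  decide ((m M.out).head? = some true)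

/-- The behaviour of `M` during `t` steps. -/
def OracleMachine.tree {τ : Type} (M : OracleMachine τ) : ℕ → M.Cfg → QueryTree τ
  | 0, c => .ret (M.outBit c.mem)
  | t + 1, c =>
    match M.code c.q with
    | .halt => .ret (M.outBit c.mem)
    | .push r b q => M.tree t ⟨q, Function.update c.mem r (b :: c.mem r)⟩
    | .pop r q => M.tree t ⟨q (c.mem r).head?, Function.update c.mem r (c.mem r).tail⟩
    | .flip q => .flip fun b => M.tree t ⟨q b, c.mem⟩
    | .query o r q => .query o (c.mem r) fun a => M.tree t ⟨q, Function.update c.mem r a⟩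

theorem OracleMachine.run_of_halt {τ S : Type} (M : OracleMachine τ) (O : Oracle τ S) {c : M.Cfg}
    (h : M.code c.q = .halt) (t : ℕ) (σ : S) : M.run O t (c, σ) = PMF.pure (c, σ) := by
  induction t with
  | zero => rfl
  | succ t ih => simp [run, step, h, ih]

/-- The tree stops at a halting state while `run` idles there for the remaining steps; `run_of_halt`
reconciles the two. Neither requires the machine to have halted when the steps run out. -/
theorem OracleMachine.run_map_outBit {τ S : Type} (M : OracleMachine τ) (O : Oracle τ S) (t : ℕ)
    (c : M.Cfg) (σ : S) :
    (M.run O t (c, σ)).map (fun c => M.outBit c.1.mem) = (M.tree t c).eval O σ := by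
  induction t generalizing c σ with
  | zero => simp [run, tree, QueryTree.eval, PMF.pure_map]
  | succ t ih =>
    rcases h : M.code c.q with _ | ⟨r, b, q⟩ | ⟨r, q⟩ | q | ⟨o, r, q⟩
    · simp [M.run_of_halt O h, tree, h, QueryTree.eval, PMF.pure_map]
    all_goals
      simp [run, step, h, tree, QueryTree.eval, PMF.map_bind, PMF.bind_map, ih, Function.comp_def]

theorem PolyAdversary.output_eq_eval_tree {τ : Type} {ℓ : ℕ → ℕ} {S : Type} (A : PolyAdversary τ ℓ)
    (κ : ℕ) (O : Oracle τ S) (σ : S) :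
    A.output κ O σ = (A.tree (A.time.eval κ) (A.init κ)).eval O σ :=
  A.run_map_outBit O _ _ _

theorem PMF.bind_congr_support {α β : Type} (p : PMF α) {f g : α → PMF β}
    (h : ∀ a ∈ p.support, f a = g a) : p.bind f = p.bind g := by
  ext b
  simp only [PMF.bind_apply]
  refine tsum_congr fun a => ?_
  by_cases ha : p a = 0
  · simp [ha]
  · rw [h a ((p.mem_support_iff a).2 ha)]

/-! ### Flowgraphs -/

/-- Loop-free programs that end with a jump to a label in `X` or with a stop. -/
inductive Block (τ R X : Type) : Type
  | goto (x : X)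
  | halt
  | push (r : R) (b : Bool) (p : Block τ R X)
  | pop (r : R) (k : Option Bool → Block τ R X)
  | flip (k : Bool → Block τ R X)
  | query (o : τ) (r : R) (p : Block τ R X)

namespace Block

variable {τ R X : Type}

/-- The control points of a program. -/
def Pos : Block τ R X → Type
  | goto _ => Unit
  | halt => Unit
  | push _ _ p => Option p.Pos
  | pop _ k => Option (Σ o, (k o).Pos)
  | flip k => Option (Σ b, (k b).Pos)
  | query _ _ p => Option p.Pos

instance finite_pos (p : Block τ R X) : Finite p.Pos := by
  induction p with
  | goto x => exact inferInstanceAs (Finite Unit)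
  | halt => exact inferInstanceAs (Finite Unit)
  | push r b p ih => exact inferInstanceAs (Finite (Option p.Pos))
  | pop r k ih => exact inferInstanceAs (Finite (Option (Σ o, (k o).Pos)))
  | flip k ih => exact inferInstanceAs (Finite (Option (Σ b, (k b).Pos)))
  | query o r p ih => exact inferInstanceAs (Finite (Option p.Pos))

/-- The control point where a program starts. -/
def entry : (p : Block τ R X) → p.Pos
  | goto _ => ()
  | halt => ()
  | push _ _ _ => none
  | pop _ _ => none
  | flip _ => none
  | query _ _ _ => none

/-- The instruction at a control point; `e` embeds the control points into a set of states, and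
`j` gives the states where the labels are. -/
def code {Q : Type} (j : X → Q) : (p : Block τ R X) → (p.Pos → Q) → p.Pos → Instr τ Q R
  -- No instruction is a plain jump, so a jump is a coin toss whose outcome is ignored; it costs one
  -- step.
  | goto x, _, _ => .flip fun _ => j x
  | halt, _, _ => .halt
  | push r b p, e, none => .push r b (e (some p.entry))
  | push _ _ p, e, some i => p.code j (fun i => e (some i)) i
  | pop r k, e, none => .pop r fun o => e (some ⟨o, (k o).entry⟩)
  | pop _ k, e, some ⟨o, i⟩ => (k o).code j (fun i => e (some ⟨o, i⟩)) i
  | flip k, e, none => .flip fun b => e (some ⟨b, (k b).entry⟩)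
  | flip k, e, some ⟨b, i⟩ => (k b).code j (fun i => e (some ⟨b, i⟩)) i
  | query o r p, e, none => .query o r (e (some p.entry))
  | query _ _ p, e, some i => p.code j (fun i => e (some i)) i

/-- The machine that executes a flowgraph. -/
def machine [Finite X] [Finite R] [DecidableEq R] (B : X → Block τ R X) (start : X)
    (inp out : R) : OracleMachine τ where
  Q := Σ x, (B x).Pos
  R := R
  start := ⟨start, (B start).entry⟩
  inp := inp
  out := out
  code := fun i => (B i.1).code (fun x => ⟨x, (B x).entry⟩) (fun j => ⟨i.1, j⟩) i.2

/-- The state of the machine at the label `x`. -/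
def label [Finite X] [Finite R] [DecidableEq R] (B : X → Block τ R X) (start : X)
    (inp out : R) (x : X) : (machine B start inp out).Q :=
  (⟨x, (B x).entry⟩ : Σ x, (B x).Pos)

/-- Started with the stacks `m` and given answers of at most `ℓ` bits, the program `p` of the
flowgraph `B` stops within `t` steps and behaves like the query tree. -/
inductive Runs [DecidableEq R] (B : X → Block τ R X) (out : R) (ℓ : ℕ) :
    Block τ R X → ℕ → (R → List Bool) → QueryTree τ → Prop
  | halt {t m} : Runs B out ℓ halt t m (.ret (decide ((m out).head? = some true)))
  | goto {t m T x} : Runs B out ℓ (B x) t m T → Runs B out ℓ (goto x) (t + 1) m T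
  | push {t m T r b p} : Runs B out ℓ p t (Function.update m r (b :: m r)) T →
      Runs B out ℓ (push r b p) (t + 1) m T
  | pop {t m T r k} : Runs B out ℓ (k (m r).head?) t (Function.update m r (m r).tail) T →
      Runs B out ℓ (pop r k) (t + 1) m T
  | flip {t m T k} : (∀ b, Runs B out ℓ (k b) t m (T b)) → Runs B out ℓ (flip k) (t + 1) m (.flip T)
  -- A coin that does not influence the behaviour leaves no trace in the tree. The coins of the
  -- machines that compute the lengths are of this kind.
  | noise {t m T k} : (∀ b, Runs B out ℓ (k b) t m T) → Runs B out ℓ (flip k) (t + 1) m T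
  | query {t m T o r p} :
      (∀ a : List Bool, a.length ≤ ℓ → Runs B out ℓ p t (Function.update m r a) (T a)) →
      Runs B out ℓ (query o r p) (t + 1) m (.query o (m r) T)

variable [DecidableEq R] {B : X → Block τ R X} {out : R} {ℓ : ℕ}

theorem Runs.query_of_eq {p : Block τ R X} {t m T o r w} (hw : m r = w)
    (h : ∀ a : List Bool, a.length ≤ ℓ → Runs B out ℓ p t (Function.update m r a) (T a)) :
    Runs B out ℓ (.query o r p) (t + 1) m (.query o w T) :=
  hw ▸ .query h

theorem Runs.halt_of_eq {t m x} (hx : decide ((m out).head? = some true) = x) :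
    Runs B out ℓ (.halt : Block τ R X) t m (.ret x) :=
  hx ▸ .halt

theorem Runs.mono {p : Block τ R X} {t m T} (h : Runs B out ℓ p t m T) :
    ∀ {t' : ℕ}, t ≤ t' → Runs B out ℓ p t' m T := by
  induction h with
  | halt => exact fun _ => .halt
  | goto _ ih => rintro (_ | t') h; · omega
                 exact .goto (ih (by omega))
  | push _ ih => rintro (_ | t') h; · omega
                 exact .push (ih (by omega))
  | pop _ ih => rintro (_ | t') h; · omega
                exact .pop (ih (by omega))
  | flip _ ih => rintro (_ | t') h; · omega
                 exact .flip fun b => ih b (by omega)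
  | noise _ ih => rintro (_ | t') h; · omega
                  exact .noise fun b => ih b (by omega)
  | query _ ih => rintro (_ | t') h; · omega
                  exact .query fun a ha => ih a ha (by omega)

variable [Finite X] [Finite R]

/-- The induction descends into proper subprograms of a block, so the claim is made for any
embedding `e` of control points along which the machine carries the code of `p`. A jump resets `e`
to the inclusion of the target block. -/
theorem Runs.haltsWithin_aux (x₀ : X) (inp : R) {p : Block τ R X} {t m T}
    (h : Runs B out ℓ p t m T) : ∀ (e : p.Pos → (machine B x₀ inp out).Q),
    (∀ i, (machine B x₀ inp out).code (e i) = p.code (label B x₀ inp out) e i) →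
    (machine B x₀ inp out).HaltsWithin ℓ (fun _ => True) t ⟨e p.entry, m⟩ := by
  induction h with
  | @halt t m =>
    intro e he
    have := he (entry _)
    simp only [entry, code] at this
    cases t <;> simp only [OracleMachine.HaltsWithin, this, entry]
    exact ⟨rfl, trivial⟩
  | goto _ ih =>
    intro e he
    have h := he (entry _)
    simp only [entry, code] at h
    simp only [OracleMachine.HaltsWithin, entry, h]
    exact fun _ => ih (fun j => (⟨_, j⟩ : Σ x, (B x).Pos)) fun i => rfl
  | push _ ih =>
    intro e he
    have h := he (entry _)
    simp only [entry, code] at h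
    simp only [OracleMachine.HaltsWithin, entry, h]
    exact ih _ fun i => he (some i)
  | pop _ ih =>
    intro e he
    have h := he (entry _)
    simp only [entry, code] at h
    simp only [OracleMachine.HaltsWithin, entry, h]
    exact ih (fun i => e (some ⟨_, i⟩)) fun i => he (some ⟨_, i⟩)
  | flip _ ih =>
    intro e he
    have h := he (entry _)
    simp only [entry, code] at h
    simp only [OracleMachine.HaltsWithin, entry, h]
    exact fun b => ih b (fun i => e (some ⟨_, i⟩)) fun i => he (some ⟨_, i⟩)
  | noise _ ih =>
    intro e he
    have h := he (entry _)
    simp only [entry, code] at h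
    simp only [OracleMachine.HaltsWithin, entry, h]
    exact fun b => ih b (fun i => e (some ⟨_, i⟩)) fun i => he (some ⟨_, i⟩)
  | query _ ih =>
    intro e he
    have h := he (entry _)
    simp only [entry, code] at h
    simp only [OracleMachine.HaltsWithin, entry, h]
    exact fun a ha => ih a ha (fun i => e (some i)) fun i => he (some i)

theorem Runs.haltsWithin (x₀ : X) (inp : R) {x : X} {t m T} (h : Runs B out ℓ (B x) t m T) :
    (machine B x₀ inp out).HaltsWithin ℓ (fun _ => True) t ⟨label B x₀ inp out x, m⟩ :=
  h.haltsWithin_aux x₀ inp (fun j => (⟨x, j⟩ : Σ x, (B x).Pos)) fun _ => rfl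

theorem Runs.eval_tree_aux (x₀ : X) (inp : R) {S : Type} {O : Oracle τ S}
    (hO : ∀ o w σ, ∀ a ∈ (O o w σ).support, a.1.length ≤ ℓ) {p : Block τ R X} {t m T}
    (h : Runs B out ℓ p t m T) : ∀ (e : p.Pos → (machine B x₀ inp out).Q) (σ : S),
    (∀ i, (machine B x₀ inp out).code (e i) = p.code (label B x₀ inp out) e i) →
    ((machine B x₀ inp out).tree t ⟨e p.entry, m⟩).eval O σ = T.eval O σ := by
  induction h with
  | @halt t m =>
    intro e σ he
    have := he (entry _)
    simp only [entry, code] at this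
    cases t <;> simp only [OracleMachine.tree, this, entry] <;> rfl
  | goto _ ih =>
    intro e σ he
    have h := he (entry _)
    simp only [entry, code] at h
    simp only [OracleMachine.tree, entry, h, QueryTree.eval]
    exact (congrArg _ (funext fun _ => ih (fun j => (⟨_, j⟩ : Σ x, (B x).Pos)) σ fun i => rfl)).trans
      (PMF.bind_const _ _)
  | push _ ih =>
    intro e σ he
    have h := he (entry _)
    simp only [entry, code] at h
    simp only [OracleMachine.tree, entry, h]
    exact ih _ σ fun i => he (some i)
  | pop _ ih =>
    intro e σ he
    have h := he (entry _)
    simp only [entry, code] at h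
    simp only [OracleMachine.tree, entry, h]
    exact ih (fun i => e (some ⟨_, i⟩)) σ fun i => he (some ⟨_, i⟩)
  | flip _ ih =>
    intro e σ he
    have h := he (entry _)
    simp only [entry, code] at h
    simp only [OracleMachine.tree, entry, h, QueryTree.eval]
    congr 1
    exact funext fun b => ih b (fun i => e (some ⟨_, i⟩)) σ fun i => he (some ⟨_, i⟩)
  | @noise t m T k _ ih =>
    intro e σ he
    have h := he (entry _)
    simp only [entry, code] at h
    simp only [OracleMachine.tree, entry, h, QueryTree.eval]
    exact (congrArg _ (funext fun b =>
      ih b (fun i => e (some ⟨_, i⟩)) σ fun i => he (some ⟨_, i⟩))).trans (PMF.bind_const _ _)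
  | query _ ih =>
    intro e σ he
    have h := he (entry _)
    simp only [entry, code] at h
    simp only [OracleMachine.tree, entry, h, QueryTree.eval]
    -- `Runs` says nothing about answers longer than `ℓ`; by `hO` these lie outside the support.
    refine PMF.bind_congr_support _ fun a ha => ?_
    exact ih a.1 (hO _ _ _ a ha) (fun i => e (some i)) a.2 fun i => he (some i)

theorem Runs.eval_tree (x₀ : X) (inp : R) {S : Type} {O : Oracle τ S}
    (hO : ∀ o w σ, ∀ a ∈ (O o w σ).support, a.1.length ≤ ℓ) {x : X} {t m T}
    (h : Runs B out ℓ (B x) t m T) (σ : S) :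
    ((machine B x₀ inp out).tree t ⟨label B x₀ inp out x, m⟩).eval O σ = T.eval O σ :=
  h.eval_tree_aux x₀ inp hO (fun j => ⟨x, j⟩) σ fun _ => rfl

end Block

/-! ### Padded words -/

/-- The first `n` bits of a word, padded with zeros. -/
def padTake (n : ℕ) (w : List Bool) : List Bool := (Bits.ofList n w).toList

@[simp] theorem Bits.length_toList {n : ℕ} (x : Bits n) : x.toList.length = n := by
  simp [Bits.toList]

@[simp] theorem length_padTake (n : ℕ) (w : List Bool) : (padTake n w).length = n := by
  simp [padTake]

@[simp] theorem padTake_zero (w : List Bool) : padTake 0 w = [] := by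
  simp [padTake, Bits.toList]

/-- This is one round of a reading loop: pop a bit, and take `false` if the stack is empty. -/
theorem padTake_succ (n : ℕ) (w : List Bool) :
    padTake (n + 1) w = w.head?.getD false :: padTake n w.tail := by
  simp only [padTake, Bits.toList, List.ofFn_succ]
  congr 1
  · cases w <;> rfl
  · congr 1
    funext i
    cases w <;> simp [Bits.ofList]

theorem Bits.toList_injective (n : ℕ) : Function.Injective (Bits.toList (n := n)) :=
  List.ofFn_injective

theorem padTake_toList {n s : ℕ} (x : Bits (n + s)) :
    padTake n x.toList = Bits.toList fun i : Fin n => x (Fin.castAdd s i) := by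
  unfold padTake
  congr 1
  funext i
  simp only [Bits.ofList, Bits.toList, List.getD_eq_getElem?_getD, List.getElem?_ofFn,
    show (i : ℕ) < n + s by omega, dite_true]
  rfl

/-- The word `v` lies beyond position `n + s`, so the oracle never reads it. Hence the distinguisher
may leave the rest of an overlong query on the stack. -/
theorem ofList_padTake_append {n s : ℕ} (w u v : List Bool) (hu : u.length = s) :
    Bits.ofList (n + s) (padTake n w ++ (u ++ v)) = Fin.append (Bits.ofList n w) (Bits.ofList s u) := by
  funext i
  refine Fin.addCases (fun i => ?_) (fun i => ?_) i
  · simp [Bits.ofList, padTake, Bits.toList, List.getD_eq_getElem?_getD, List.getElem?_append_left]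
  · simp [Bits.ofList, padTake, Bits.toList, List.getD_eq_getElem?_getD, List.getElem?_append_right,
      List.getElem?_append_left, hu]

@[simp] theorem Bits.ofList_toList {n : ℕ} (x : Bits n) : Bits.ofList n x.toList = x := by
  funext i
  simp [Bits.ofList, Bits.toList, List.getD_eq_getElem?_getD]

theorem ofList_padTake {n : ℕ} (w v : List Bool) :
    Bits.ofList n (padTake n w ++ v) = Bits.ofList n w := by
  funext i
  simp [Bits.ofList, padTake, Bits.toList, List.getD_eq_getElem?_getD, List.getElem?_append_left]

theorem Bits.toList_snoc {n : ℕ} (x : Bits n) (b : Bool) :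
    Bits.toList (n := n + 1) (Fin.snoc (α := fun _ => Bool) x b) = x.toList ++ [b] := by
  simp only [Bits.toList, List.ofFn_succ', Fin.snoc_castSucc, Fin.snoc_last, List.concat_eq_append]

/-! ### The scheme with a given permutation -/

/-- The oracles of the CCA game for the scheme that encrypts with the permutation `π`. -/
noncomputable def permCCAOracle {n s : ℕ} (π : Equiv.Perm (Bits (n + s))) (b : Bool) :
    Oracle CCAQuery (Option (Bits (n + s)))
  | .enc, w, σ => (PMF.uniformOfFintype (Bits s)).map fun u =>
      (Bits.toList (π (Fin.append (Bits.ofList n w) u)), σ)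
  | .dec, w, σ => PMF.pure (if σ = some (Bits.ofList (n + s) w) then []
      else Bits.toList fun i : Fin n => π.symm (Bits.ofList (n + s) w) (Fin.castAdd s i), σ)
  | .chal, w, none => (PMF.uniformOfFintype (Bits s)).map fun u =>
      (Bits.toList (π (Fin.append (Bits.ofList n (if b then w.drop n else w)) u)),
        some (π (Fin.append (Bits.ofList n (if b then w.drop n else w)) u)))
  | .chal, _, some c => PMF.pure ([], some c)

theorem ccaOracle_seScheme (n s : ℕ → ℕ) (P : KeyedPerm fun κ => n κ + s κ) (κ : ℕ)
    (k : Bits (n κ + s κ)) (b : Bool) :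
    ccaOracle (seScheme n s P) κ k b = permCCAOracle (P κ k) b := by
  funext o w σ
  cases o with
  | enc => simp [ccaOracle, seScheme, permCCAOracle, PMF.map_comp, Function.comp_def]
  | dec => rfl
  | chal =>
    cases σ with
    | none => cases b <;>
        simp [ccaOracle, seScheme, permCCAOracle, PMF.map_comp, Function.comp_def]
    | some c => rfl

/-! ### Coins -/

theorem PMF.map_equiv_uniformOfFintype {α β : Type} [Fintype α] [Fintype β] [Nonempty α]
    [Nonempty β] (e : α ≃ β) : (PMF.uniformOfFintype α).map e = PMF.uniformOfFintype β := by
  ext b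
  rw [PMF.map_apply, tsum_eq_single (e.symm b)]
  · simp [Fintype.card_congr e]
  · intro a ha
    rw [if_neg]
    rintro rfl
    simp at ha

theorem PMF.uniformOfFintype_prod_bind {α β γ : Type} [Fintype α] [Fintype β] [Nonempty α]
    [Nonempty β] (f : α → β → PMF γ) :
    (PMF.uniformOfFintype (α × β)).bind (fun x => f x.1 x.2) =
      (PMF.uniformOfFintype α).bind fun a => (PMF.uniformOfFintype β).bind fun b => f a b := by
  ext c
  simp only [PMF.bind_apply, PMF.uniformOfFintype_apply, tsum_fintype, Fintype.sum_prod_type,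
    Finset.mul_sum, Fintype.card_prod, Nat.cast_mul, ← mul_assoc]
  rw [ENNReal.mul_inv (by simp) (by simp)]

namespace QueryTree

variable {τ : Type}

/-- Toss `s` coins; the last one comes first in the resulting word. -/
def flips : ℕ → (List Bool → QueryTree τ) → QueryTree τ
  | 0, f => f []
  | s + 1, f => .flip fun x => flips s fun u => f (u ++ [x])

theorem eval_flips {S : Type} (O : Oracle τ S) (s : ℕ) (f : List Bool → QueryTree τ) (σ : S) :
    (flips s f).eval O σ = (PMF.uniformOfFintype (Bits s)).bind fun u => (f u.toList).eval O σ := by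
  induction s generalizing f with
  | zero =>
    have : ∀ u : Bits 0, u.toList = [] := fun u => by simp [Bits.toList]
    simp only [this, PMF.bind_const, flips]
  | succ s ih =>
    simp only [flips, eval, ih]
    -- The coin tossed first becomes the last bit, hence `Fin.snocEquiv` rather than
    -- `Fin.consEquiv`.
    rw [← PMF.uniformOfFintype_prod_bind fun x (u : Bits s) => (f (u.toList ++ [x])).eval O σ,
      ← PMF.map_equiv_uniformOfFintype (Fin.snocEquiv fun _ : Fin (s + 1) => Bool), PMF.bind_map]
    congr 1
    funext x
    simp only [Function.comp_apply, Fin.snocEquiv, Equiv.coe_fn_mk, Bits.toList_snoc]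

/-! ### Simulation of the CCA game -/

/-- The CCA game with challenge bit `b` played with access to a permutation and its inverse. The
state is the challenge ciphertext. The result is whether the challenge bit has been guessed. -/
def simulate (n s : ℕ) (b : Bool) : QueryTree CCAQuery → Option (List Bool) → QueryTree PermQuery
  | ret x, _ => ret (x == b)
  | flip k, σ => flip fun x => (k x).simulate n s b σ
  | query .enc w k, σ => flips s fun u =>
      query .fwd (padTake n w ++ (u ++ w.drop n)) fun a => (k a).simulate n s b σ
  | query .dec w k, none =>
      query .inv w fun a => (k (padTake n a)).simulate n s b none
  | query .dec w k, some c =>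
      query .inv (padTake c.length w ++ w.drop c.length) fun a =>
        (k (if padTake c.length w = c then [] else padTake n a)).simulate n s b (some c)
  | query .chal w k, none => flips s fun u =>
      query .fwd (padTake n (if b then w.drop n else w) ++
        (u ++ (if b then w.drop n else w).drop n)) fun a => (k a).simulate n s b (some a)
  | query .chal w k, some c => query .inv w fun _ => (k []).simulate n s b (some c)

/-- The permutation oracles are deterministic and stateless, so the extra inverse queries made when
the attacker is refused have no effect. Injectivity of `Bits.toList` makes the comparison of padded
words the same as the comparison of ciphertexts. -/
theorem eval_simulate {n s : ℕ} (π : Equiv.Perm (Bits (n + s))) (b : Bool)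
    (T : QueryTree CCAQuery) (σ : Option (Bits (n + s))) :
    (T.simulate n s b (σ.map Bits.toList)).eval (permOracle π) () =
      (T.eval (permCCAOracle π b) σ).map fun b' => b' == b := by
  induction T generalizing σ with
  | ret x => simp [simulate, eval, PMF.pure_map]
  | flip k ih => simp [simulate, eval, PMF.map_bind, ih]
  | query o w k ih =>
    cases o with
    | enc =>
      simp [simulate, eval, eval_flips, permOracle, permCCAOracle, PMF.map_bind, PMF.bind_map, ← ih,
        Function.comp_def, ofList_padTake_append]
    | dec =>
      cases σ with
      | none =>
        have := ih (Bits.toList fun i : Fin n => π.symm (Bits.ofList (n + s) w) (Fin.castAdd s i))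
          none
        simpa [simulate, eval, permOracle, permCCAOracle, padTake_toList] using this
      | some c =>
        have h : (padTake (n + s) w = c.toList) ↔ c = Bits.ofList (n + s) w := by
          rw [padTake, (Bits.toList_injective _).eq_iff, eq_comm]
        by_cases hc : c = Bits.ofList (n + s) w
        · have := ih [] (some c)
          simp only [Option.map_some] at this
          simp [simulate, eval, permOracle, permCCAOracle, h, ← this, ← hc]
        · have := ih (Bits.toList fun i : Fin n =>
            π.symm (Bits.ofList (n + s) w) (Fin.castAdd s i)) (some c)
          simp only [Option.map_some] at this
          simp [simulate, eval, permOracle, permCCAOracle, h, ← this, hc, padTake_toList,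
            ofList_padTake]
    | chal =>
      cases σ with
      | none =>
        simp only [simulate, eval, eval_flips, permOracle, permCCAOracle, PMF.map_bind,
          PMF.bind_map, Function.comp_def, Option.map_none, PMF.pure_bind, ← ih, Option.map_some]
        congr 1
        funext u
        rw [ofList_padTake_append _ _ _ (by simp), Bits.ofList_toList]
      | some c =>
        have := ih [] (some c)
        simp only [Option.map_some] at this
        simp [simulate, eval, permOracle, permCCAOracle, ← this]

end QueryTree

/-! ### The distinguisher -/

namespace Reduction

/-- The stacks of the distinguisher: those of the attacker, those of the two machines that compute
the lengths, counters for the two lengths (with the used-up part), a scratch stack, and the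
challenge ciphertext (with the part already read). -/
inductive Stk (R₁ R₂ R₃ : Type) : Type
  | att (r : R₁)
  | lenN (r : R₂)
  | lenS (r : R₃)
  | cn
  | cnUsed
  | cs
  | csUsed
  | tmp
  | ct
  | ctRead
  deriving DecidableEq

instance (R₁ R₂ R₃ : Type) [Finite R₁] [Finite R₂] [Finite R₃] : Finite (Stk R₁ R₂ R₃) := by
  refine Finite.of_surjective (α := R₁ ⊕ R₂ ⊕ R₃ ⊕ Fin 7)
    (Sum.elim .att (Sum.elim .lenN (Sum.elim .lenS
      ![.cn, .cnUsed, .cs, .csUsed, .tmp, .ct, .ctRead]))) ?_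
  rintro (r | r | r | _)
  · exact ⟨.inl r, rfl⟩
  · exact ⟨.inr (.inl r), rfl⟩
  · exact ⟨.inr (.inr (.inl r)), rfl⟩
  · exact ⟨.inr (.inr (.inr 0)), rfl⟩
  · exact ⟨.inr (.inr (.inr 1)), rfl⟩
  · exact ⟨.inr (.inr (.inr 2)), rfl⟩
  · exact ⟨.inr (.inr (.inr 3)), rfl⟩
  · exact ⟨.inr (.inr (.inr 4)), rfl⟩
  · exact ⟨.inr (.inr (.inr 5)), rfl⟩
  · exact ⟨.inr (.inr (.inr 6)), rfl⟩

/-- The contents of the stacks of the distinguisher. -/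
structure Store (R₁ R₂ R₃ : Type) : Type where
  att : R₁ → List Bool
  lenN : R₂ → List Bool
  lenS : R₃ → List Bool
  cn : List Bool
  cnUsed : List Bool
  cs : List Bool
  csUsed : List Bool
  tmp : List Bool
  ct : List Bool
  ctRead : List Bool

variable {R₁ R₂ R₃ : Type}

namespace Store

/-- The contents of the stacks as a function. -/
def mem (S : Store R₁ R₂ R₃) : Stk R₁ R₂ R₃ → List Bool
  | .att r => S.att r
  | .lenN r => S.lenN r
  | .lenS r => S.lenS r
  | .cn => S.cn
  | .cnUsed => S.cnUsed
  | .cs => S.cs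
  | .csUsed => S.csUsed
  | .tmp => S.tmp
  | .ct => S.ct
  | .ctRead => S.ctRead

variable [DecidableEq R₁] [DecidableEq R₂] [DecidableEq R₃] (S : Store R₁ R₂ R₃) (l : List Bool)

@[simp] theorem update_att (r : R₁) : Function.update S.mem (.att r) l =
    mem { S with att := Function.update S.att r l } := by
  funext x; cases x <;> simp [Function.update_apply, mem]

@[simp] theorem update_lenN (r : R₂) : Function.update S.mem (.lenN r) l =
    mem { S with lenN := Function.update S.lenN r l } := by
  funext x; cases x <;> simp [Function.update_apply, mem]

@[simp] theorem update_lenS (r : R₃) : Function.update S.mem (.lenS r) l =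
    mem { S with lenS := Function.update S.lenS r l } := by
  funext x; cases x <;> simp [Function.update_apply, mem]

@[simp] theorem update_cn : Function.update S.mem .cn l = mem { S with cn := l } := by
  funext x; cases x <;> simp [mem]

@[simp] theorem update_cnUsed : Function.update S.mem .cnUsed l = mem { S with cnUsed := l } := by
  funext x; cases x <;> simp [mem]

@[simp] theorem update_cs : Function.update S.mem .cs l = mem { S with cs := l } := by
  funext x; cases x <;> simp [mem]

@[simp] theorem update_csUsed : Function.update S.mem .csUsed l = mem { S with csUsed := l } := by
  funext x; cases x <;> simp [mem]

@[simp] theorem update_tmp : Function.update S.mem .tmp l = mem { S with tmp := l } := by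
  funext x; cases x <;> simp [mem]

@[simp] theorem update_ct : Function.update S.mem .ct l = mem { S with ct := l } := by
  funext x; cases x <;> simp [mem]

@[simp] theorem update_ctRead : Function.update S.mem .ctRead l = mem { S with ctRead := l } := by
  funext x; cases x <;> simp [mem]

end Store

/-- The purpose for which a message is read from or written to a stack. -/
inductive Mode : Type
  | enc
  | chal
  | dec
  deriving DecidableEq

instance : Fintype Mode := ⟨{.enc, .chal, .dec}, by rintro (_ | _ | _) <;> decide⟩

/-- The loops that answer the queries of the attacker. -/
inductive Phase : Type
  /-- drop the first message -/
  | skip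
  | unskip
  /-- move a message to the scratch stack -/
  | load (i : Mode)
  /-- write a random salt -/
  | salt (i : Mode)
  | unsalt (i : Mode)
  /-- move a message back from the scratch stack -/
  | unload (i : Mode)
  /-- keep a copy of the challenge ciphertext -/
  | copy
  | paste
  /-- compare with the challenge ciphertext -/
  | cmp (e : Bool)
  | uncmp (e : Bool)
  /-- erase a stack -/
  | clear (refuse : Bool)
  deriving Fintype

/-- The labels of the flowgraph of the distinguisher. The bit `b` is the challenge bit and `f` says
whether the challenge has been made. -/
inductive Label (Q₁ R₁ Q₂ Q₃ : Type) : Type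
  | copyInput
  | runN (q : Q₂)
  | moveN
  | runS (q : Q₃)
  | moveS
  | sim (b f : Bool) (q : Q₁)
  | phase (i : Phase) (b f : Bool) (r : R₁) (q : Q₁)

instance (Q₁ R₁ Q₂ Q₃ : Type) [Finite Q₁] [Finite R₁] [Finite Q₂] [Finite Q₃] :
    Finite (Label Q₁ R₁ Q₂ Q₃) := by
  refine Finite.of_surjective
    (α := Fin 3 ⊕ Q₂ ⊕ Q₃ ⊕ (Bool × Bool × Q₁) ⊕ (Phase × Bool × Bool × R₁ × Q₁))
    (Sum.elim ![.copyInput, .moveN, .moveS] (Sum.elim .runN (Sum.elim .runS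
      (Sum.elim (fun x => .sim x.1 x.2.1 x.2.2)
        fun x => .phase x.1 x.2.1 x.2.2.1 x.2.2.2.1 x.2.2.2.2)))) ?_
  rintro (_ | q | _ | q | _ | ⟨b, f, q⟩ | ⟨i, b, f, r, q⟩)
  · exact ⟨.inl 0, rfl⟩
  · exact ⟨.inr (.inl q), rfl⟩
  · exact ⟨.inl 1, rfl⟩
  · exact ⟨.inr (.inr (.inl q)), rfl⟩
  · exact ⟨.inl 2, rfl⟩
  · exact ⟨.inr (.inr (.inr (.inl (b, f, q)))), rfl⟩
  · exact ⟨.inr (.inr (.inr (.inr (i, b, f, r, q)))), rfl⟩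

variable (M : OracleMachine CCAQuery) (U V : OracleMachine Empty)

/-- The programs of the distinguisher. -/
abbrev Prog : Type := Block PermQuery (Stk M.R U.R V.R) (Label M.Q M.R U.Q V.Q)

variable {M U V}

/-- What to do when a message has been read. -/
def afterLoad (b f : Bool) (r : M.R) (q : M.Q) : Mode → Prog M U V
  | .dec => .goto (.phase (.clear false) b f r q)
  | i => .goto (.phase (.salt i) b f r q)

/-- What to do when a message has been written. -/
def afterUnload (b f : Bool) (r : M.R) (q : M.Q) : Mode → Prog M U V
  | .enc => .query .fwd (.att r) (.goto (.sim b f q))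
  | .chal => .query .fwd (.att r) (.goto (.phase .copy b f r q))
  | .dec => .goto (.sim b f q)

/-- The loops that answer the queries of the attacker. -/
def phaseBlock (b f : Bool) (r : M.R) (q : M.Q) : Phase → Prog M U V
  -- The lengths are unary counters. A loop that consumes one saves its bits on the companion stack,
  -- and a later loop runs back to restore it.
  | .skip => .pop .cn fun
      | none => .goto (.phase .unskip b f r q)
      | some d => .push .cnUsed d <| .pop (.att r) fun _ => .goto (.phase .skip b f r q)
  | .unskip => .pop .cnUsed fun
      | none => .goto (.phase (.load .chal) b f r q)
      | some d => .push .cn d <| .goto (.phase .unskip b f r q)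
  | .load i => .pop .cn fun
      | none => afterLoad b f r q i
      | some d => .push .cnUsed d <| .pop (.att r) fun o => .push .tmp (o.getD false) <|
          .goto (.phase (.load i) b f r q)
  | .salt i => .pop .cs fun
      | none => .goto (.phase (.unsalt i) b f r q)
      | some d => .push .csUsed d <| .flip fun x => .push (.att r) x <|
          .goto (.phase (.salt i) b f r q)
  | .unsalt i => .pop .csUsed fun
      | none => .goto (.phase (.unload i) b f r q)
      | some d => .push .cs d <| .goto (.phase (.unsalt i) b f r q)
  | .unload i => .pop .cnUsed fun
      | none => afterUnload b f r q i
      | some d => .push .cn d <| .pop .tmp fun o => .push (.att r) (o.getD false) <|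
          .goto (.phase (.unload i) b f r q)
  | .copy => .pop (.att r) fun
      | none => .goto (.phase .paste b f r q)
      | some x => .push .tmp x <| .goto (.phase .copy b f r q)
  | .paste => .pop .tmp fun
      | none => .goto (.sim b true q)
      | some x => .push (.att r) x <| .push .ct x <| .goto (.phase .paste b f r q)
  | .cmp e => .pop .ct fun
      | none => .goto (.phase (.uncmp e) b f r q)
      | some y => .push .ctRead y <| .pop (.att r) fun o => .push .tmp (o.getD false) <|
          .goto (.phase (.cmp (e && (o.getD false == y))) b f r q)
  | .uncmp e => .pop .ctRead fun
      | none => .query .inv (.att r) <|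
          .goto (.phase (if e then .clear true else .load .dec) b f r q)
      | some y => .push .ct y <| .pop .tmp fun o => .push (.att r) (o.getD false) <|
          .goto (.phase (.uncmp e) b f r q)
  | .clear e => .pop (.att r) fun
      | none => .goto (if e then .sim b f q else .phase (.unload .dec) b f r q)
      | some _ => .goto (.phase (.clear e) b f r q)

/-- The simulation of the attacker. -/
def simBlock (b f : Bool) (q : M.Q) : Prog M U V :=
  match M.code q with
  | .halt => .pop (.att M.out) fun o => .push .tmp (decide (o = some true) == b) .halt
  | .push r x q => .push (.att r) x <| .goto (.sim b f q)
  | .pop r k => .pop (.att r) fun o => .goto (.sim b f (k o))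
  | .flip k => .flip fun x => .goto (.sim b f (k x))
  | .query .enc r q => .goto (.phase (.load .enc) b f r q)
  | .query .dec r q =>
      if f then .goto (.phase (.cmp true) b f r q)
      else .query .inv (.att r) <| .goto (.phase (.load .dec) b f r q)
  | .query .chal r q =>
      -- The answer is thrown away. The query serves to replace a word of unknown length by one of
      -- at most `ℓ` bits, which bounds the time for erasing it.
      if f then .query .inv (.att r) <| .goto (.phase (.clear true) b f r q)
      else .goto (.phase (if b then .skip else .load .chal) b f r q)

/-- A machine without oracles as a flowgraph. -/
def lengthBlock {R Q : Type} {W : OracleMachine Empty} (j : W.R → R) (x : W.Q → Q) (y : Q)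
    (q : W.Q) : Block PermQuery R Q :=
  match W.code q with
  | .halt => .goto y
  | .push r b q => .push (j r) b <| .goto (x q)
  | .pop r k => .pop (j r) fun o => .goto (x (k o))
  | .flip k => .flip fun b => .goto (x (k b))
  | .query o _ _ => o.elim

variable (M U V) in
/-- The flowgraph of the distinguisher. The lengths are computed, then a challenge bit is drawn and
the attacker is simulated. -/
def block : Label M.Q M.R U.Q V.Q → Prog M U V
  | .copyInput => .pop .tmp fun
      | none => .goto (.runN U.start)
      | some d => .push (.lenN U.inp) d <| .push (.lenS V.inp) d <| .push (.att M.inp) d <|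
          .goto .copyInput
  | .runN q => lengthBlock .lenN .runN .moveN q
  | .moveN => .pop (.lenN U.out) fun
      | none => .goto (.runS V.start)
      | some d => .push .cn d <| .goto .moveN
  | .runS q => lengthBlock .lenS .runS .moveS q
  | .moveS => .pop (.lenS V.out) fun
      | none => .flip fun b => .goto (.sim b false M.start)
      | some d => .push .cs d <| .goto .moveS
  | .sim b f q => simBlock b f q
  | .phase i b f r q => phaseBlock b f r q i

/-! ### Effect and running time of the individual loops -/

open Block QueryTree

variable {ℓ t : ℕ} {b f e : Bool} {r : M.R} {q : M.Q} {i : Mode} {T : QueryTree PermQuery}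
  {a : M.R → List Bool} {u : U.R → List Bool} {v : V.R → List Bool}
  {cn cn' cs cs' tmp ct ct' : List Bool}

variable (M U V) in
/-- The distinguisher, started at the program `p` with the given stacks, stops within `t` steps and
behaves like the query tree. -/
abbrev Acts (ℓ : ℕ) (p : Prog M U V) (t : ℕ) (S : Store M.R U.R V.R) (T : QueryTree PermQuery) :
    Prop :=
  Runs (block M U V) .tmp ℓ p t S.mem T

/-- As for all loops below, the proof is by induction on the stack that controls the loop. Here a
round takes four steps (pop, push, pop, jump) and the final pop one more; the continuation is
charged to `t`. -/
theorem acts_skip (l cn' w : List Bool)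
    (h : Acts M U V ℓ (.goto (.phase .unskip b f r q)) t
      ⟨Function.update a r (w.drop l.length), u, v, [], l.reverse ++ cn', cs, cs', tmp, ct, ct'⟩ T) :
    Acts M U V ℓ (block M U V (.phase .skip b f r q)) (t + 4 * l.length + 1)
      ⟨Function.update a r w, u, v, l, cn', cs, cs', tmp, ct, ct'⟩ T := by
  induction l generalizing cn' w with
  | nil => exact .pop (by simpa [Store.mem] using h)
  | cons d l ih =>
    rw [show t + 4 * (d :: l).length + 1 = t + 4 * l.length + 1 + 1 + 1 + 1 + 1 by simp; ring]
    refine .pop ?_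
    simp only [Store.mem, Store.update_cn, List.head?_cons, List.tail_cons]
    refine .push (.pop (.goto ?_))
    simpa [Store.mem] using ih (d :: cn') w.tail (by simpa using h)

end Reduction

namespace Reduction

open Block QueryTree

variable {M : OracleMachine CCAQuery} {U V : OracleMachine Empty}
  {ℓ t : ℕ} {b f e : Bool} {r : M.R} {q : M.Q} {i : Mode} {T : QueryTree PermQuery}
  {a : M.R → List Bool} {u : U.R → List Bool} {v : V.R → List Bool}
  {cn cn' cs cs' tmp ct ct' : List Bool}

theorem acts_unskip (l cn : List Bool)
    (h : Acts M U V ℓ (.goto (.phase (.load .chal) b f r q)) t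
      ⟨a, u, v, l.reverse ++ cn, [], cs, cs', tmp, ct, ct'⟩ T) :
    Acts M U V ℓ (block M U V (.phase .unskip b f r q)) (t + 3 * l.length + 1)
      ⟨a, u, v, cn, l, cs, cs', tmp, ct, ct'⟩ T := by
  induction l generalizing cn with
  | nil => exact .pop (by simpa [Store.mem] using h)
  | cons d l ih =>
    rw [show t + 3 * (d :: l).length + 1 = t + 3 * l.length + 1 + 1 + 1 + 1 by simp; ring]
    refine .pop ?_
    simp only [Store.mem, Store.update_cnUsed, List.head?_cons, List.tail_cons]
    refine .push (.goto ?_)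
    simpa [Store.mem] using ih (d :: cn) (by simpa using h)

theorem acts_load (l cn' tmp w : List Bool)
    (h : Acts M U V ℓ (afterLoad b f r q i) t
      ⟨Function.update a r (w.drop l.length), u, v, [], l.reverse ++ cn', cs, cs',
        (padTake l.length w).reverse ++ tmp, ct, ct'⟩ T) :
    Acts M U V ℓ (block M U V (.phase (.load i) b f r q)) (t + 5 * l.length + 1)
      ⟨Function.update a r w, u, v, l, cn', cs, cs', tmp, ct, ct'⟩ T := by
  induction l generalizing cn' tmp w with
  | nil => exact .pop (by simpa [Store.mem] using h)
  | cons d l ih =>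
    rw [show t + 5 * (d :: l).length + 1 = t + 5 * l.length + 1 + 1 + 1 + 1 + 1 + 1 by simp; ring]
    refine .pop ?_
    simp only [Store.mem, Store.update_cn, List.head?_cons, List.tail_cons]
    refine .push (.pop (.push (.goto ?_)))
    simpa [Store.mem] using ih (d :: cn') (w.head?.getD false :: tmp) w.tail
      (by simpa [padTake_succ] using h)

theorem acts_unload (l x cn w : List Bool) (hx : x.length = l.length)
    (h : Acts M U V ℓ (afterUnload b f r q i) t
      ⟨Function.update a r (x.reverse ++ w), u, v, l.reverse ++ cn, [], cs, cs', [], ct, ct'⟩ T) :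
    Acts M U V ℓ (block M U V (.phase (.unload i) b f r q)) (t + 5 * l.length + 1)
      ⟨Function.update a r w, u, v, cn, l, cs, cs', x, ct, ct'⟩ T := by
  induction l generalizing x cn w with
  | nil =>
    obtain rfl := List.length_eq_zero_iff.1 hx
    exact .pop (by simpa [Store.mem] using h)
  | cons d l ih =>
    obtain ⟨y, x, rfl⟩ := List.exists_cons_of_length_eq_add_one hx
    rw [show t + 5 * (d :: l).length + 1 = t + 5 * l.length + 1 + 1 + 1 + 1 + 1 + 1 by simp; ring]
    refine .pop ?_
    simp only [Store.mem, Store.update_cnUsed, List.head?_cons, List.tail_cons]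
    refine .push (.pop (.push (.goto ?_)))
    simpa [Store.mem] using ih x (d :: cn) (y :: w) (by simpa using hx) (by simpa using h)

/-- The first coin ends up deepest on the stack, which is the order of `flips`; the induction
hypothesis is used for the tree `fun x => T (x ++ [y])`. -/
theorem acts_salt (l cs' w : List Bool) {T : List Bool → QueryTree PermQuery}
    (h : ∀ x : List Bool, x.length = l.length → Acts M U V ℓ (.goto (.phase (.unsalt i) b f r q)) t
      ⟨Function.update a r (x ++ w), u, v, cn, cn', [], l.reverse ++ cs', tmp, ct, ct'⟩ (T x)) :
    Acts M U V ℓ (block M U V (.phase (.salt i) b f r q)) (t + 5 * l.length + 1)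
      ⟨Function.update a r w, u, v, cn, cn', l, cs', tmp, ct, ct'⟩ (flips l.length T) := by
  induction l generalizing cs' w T with
  | nil => exact .pop (by simpa [Store.mem, flips] using h [] rfl)
  | cons d l ih =>
    rw [show t + 5 * (d :: l).length + 1 = t + 5 * l.length + 1 + 1 + 1 + 1 + 1 + 1 by simp; ring]
    refine .pop ?_
    simp only [Store.mem, Store.update_cs, List.head?_cons, List.tail_cons]
    refine .push (.flip fun y => .push (.goto ?_))
    simpa [Store.mem] using ih (d :: cs') (y :: w) fun x hx => by
      simpa using h (x ++ [y]) (by simpa using hx)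

theorem acts_unsalt (l cs : List Bool)
    (h : Acts M U V ℓ (.goto (.phase (.unload i) b f r q)) t
      ⟨a, u, v, cn, cn', l.reverse ++ cs, [], tmp, ct, ct'⟩ T) :
    Acts M U V ℓ (block M U V (.phase (.unsalt i) b f r q)) (t + 3 * l.length + 1)
      ⟨a, u, v, cn, cn', cs, l, tmp, ct, ct'⟩ T := by
  induction l generalizing cs with
  | nil => exact .pop (by simpa [Store.mem] using h)
  | cons d l ih =>
    rw [show t + 3 * (d :: l).length + 1 = t + 3 * l.length + 1 + 1 + 1 + 1 by simp; ring]
    refine .pop ?_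
    simp only [Store.mem, Store.update_csUsed, List.head?_cons, List.tail_cons]
    refine .push (.goto ?_)
    simpa [Store.mem] using ih (d :: cs) (by simpa using h)

theorem acts_copy (w tmp : List Bool)
    (h : Acts M U V ℓ (.goto (.phase .paste b f r q)) t
      ⟨Function.update a r [], u, v, cn, cn', cs, cs', w.reverse ++ tmp, ct, ct'⟩ T) :
    Acts M U V ℓ (block M U V (.phase .copy b f r q)) (t + 3 * w.length + 1)
      ⟨Function.update a r w, u, v, cn, cn', cs, cs', tmp, ct, ct'⟩ T := by
  induction w generalizing tmp with
  | nil => exact .pop (by simpa [Store.mem] using h)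
  | cons d l ih =>
    rw [show t + 3 * (d :: l).length + 1 = t + 3 * l.length + 1 + 1 + 1 + 1 by simp; ring]
    refine .pop ?_
    simp only [Store.mem, Store.update_att, Function.update_self, List.head?_cons, List.tail_cons]
    refine .push (.goto ?_)
    simpa [Store.mem] using ih (d :: tmp) (by simpa using h)

theorem acts_paste (l w ct : List Bool)
    (h : Acts M U V ℓ (.goto (.sim b true q)) t
      ⟨Function.update a r (l.reverse ++ w), u, v, cn, cn', cs, cs', [], l.reverse ++ ct, ct'⟩ T) :
    Acts M U V ℓ (block M U V (.phase .paste b f r q)) (t + 4 * l.length + 1)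
      ⟨Function.update a r w, u, v, cn, cn', cs, cs', l, ct, ct'⟩ T := by
  induction l generalizing w ct with
  | nil => exact .pop (by simpa [Store.mem] using h)
  | cons d l ih =>
    rw [show t + 4 * (d :: l).length + 1 = t + 4 * l.length + 1 + 1 + 1 + 1 + 1 by simp; ring]
    refine .pop ?_
    simp only [Store.mem, Store.update_tmp, List.head?_cons, List.tail_cons]
    refine .push (.push (.goto ?_))
    simpa [Store.mem] using ih (d :: w) (d :: ct) (by simpa using h)

/-- The bit `e` accumulates the conjunction of the bitwise comparisons. All bits that are read are
kept, so that `acts_uncmp` can restore both words. -/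
theorem acts_cmp (l ct' tmp w : List Bool)
    (h : Acts M U V ℓ (.goto (.phase (.uncmp (e && (padTake l.length w == l))) b f r q)) t
      ⟨Function.update a r (w.drop l.length), u, v, cn, cn', cs, cs',
        (padTake l.length w).reverse ++ tmp, [], l.reverse ++ ct'⟩ T) :
    Acts M U V ℓ (block M U V (.phase (.cmp e) b f r q)) (t + 5 * l.length + 1)
      ⟨Function.update a r w, u, v, cn, cn', cs, cs', tmp, l, ct'⟩ T := by
  induction l generalizing ct' tmp w e with
  | nil => exact .pop (by simpa [Store.mem] using h)
  | cons d l ih =>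
    rw [show t + 5 * (d :: l).length + 1 = t + 5 * l.length + 1 + 1 + 1 + 1 + 1 + 1 by simp; ring]
    refine .pop ?_
    simp only [Store.mem, Store.update_ct, List.head?_cons, List.tail_cons]
    refine .push (.pop (.push (.goto ?_)))
    simpa [Store.mem] using ih (e := e && (w.head?.getD false == d)) (d :: ct')
      (w.head?.getD false :: tmp) w.tail
      (by simpa [padTake_succ, List.cons_beq_cons, Bool.and_assoc] using h)

theorem acts_uncmp (l x ct w : List Bool) (hx : x.length = l.length) {T : List Bool → QueryTree PermQuery}
    (h : ∀ y : List Bool, y.length ≤ ℓ →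
      Acts M U V ℓ (.goto (.phase (if e then .clear true else .load .dec) b f r q)) t
      ⟨Function.update a r y, u, v, cn, cn', cs, cs', [], l.reverse ++ ct, []⟩ (T y)) :
    Acts M U V ℓ (block M U V (.phase (.uncmp e) b f r q)) (t + 5 * l.length + 2)
      ⟨Function.update a r w, u, v, cn, cn', cs, cs', x, ct, l⟩ (.query .inv (x.reverse ++ w) T) := by
  induction l generalizing x ct w with
  | nil =>
    obtain rfl := List.length_eq_zero_iff.1 hx
    refine .pop ?_
    simp only [Store.mem, Store.update_ctRead, List.head?_nil, List.tail_nil, List.reverse_nil,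
      List.nil_append]
    exact .query_of_eq (by simp [Store.mem]) fun y hy => by simpa using h y hy
  | cons d l ih =>
    obtain ⟨y, x, rfl⟩ := List.exists_cons_of_length_eq_add_one hx
    rw [show t + 5 * (d :: l).length + 2 = t + 5 * l.length + 2 + 1 + 1 + 1 + 1 + 1 by simp; ring]
    refine .pop ?_
    simp only [Store.mem, Store.update_ctRead, List.head?_cons, List.tail_cons]
    refine .push (.pop (.push (.goto ?_)))
    simpa [Store.mem] using ih x (d :: ct) (y :: w) (by simpa using hx) (by simpa using h)

theorem acts_clear (w : List Bool)
    (h : Acts M U V ℓ (.goto (if e then .sim b f q else .phase (.unload .dec) b f r q)) t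
      ⟨Function.update a r [], u, v, cn, cn', cs, cs', tmp, ct, ct'⟩ T) :
    Acts M U V ℓ (block M U V (.phase (.clear e) b f r q)) (t + 2 * w.length + 1)
      ⟨Function.update a r w, u, v, cn, cn', cs, cs', tmp, ct, ct'⟩ T := by
  induction w with
  | nil => exact .pop (by simpa [Store.mem] using h)
  | cons d l ih =>
    rw [show t + 2 * (d :: l).length + 1 = t + 2 * l.length + 1 + 1 + 1 by simp; ring]
    refine .pop ?_
    simp only [Store.mem, Store.update_att, Function.update_self, List.head?_cons, List.tail_cons]
    refine .goto ?_
    simpa [Store.mem] using ih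

end Reduction

/-! ### Complete answers to queries, and the simulation of the attacker -/

namespace Reduction

open Block QueryTree

variable {M : OracleMachine CCAQuery} {U V : OracleMachine Empty}
  {ℓ t : ℕ} {b f e : Bool} {r : M.R} {q : M.Q} {i : Mode} {T : QueryTree PermQuery}
  {a : M.R → List Bool} {u : U.R → List Bool} {v : V.R → List Bool}
  {cn cs ct w : List Bool}

/-- The message is moved aside, the salt is pushed on what remains of the word, and the message is
put back on top; restoring the counters `cs` and `cn` is interleaved with this. -/
theorem acts_write (hi : i ≠ .dec) {T : List Bool → QueryTree PermQuery}
    (h : ∀ x : List Bool, x.length = cs.length → Acts M U V ℓ (afterUnload b f r q i) t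
      ⟨Function.update a r (padTake cn.length w ++ (x ++ w.drop cn.length)), u, v,
        cn, [], cs, [], [], ct, []⟩ (T x)) :
    Acts M U V ℓ (block M U V (.phase (.load i) b f r q)) (t + 10 * cn.length + 8 * cs.length + 7)
      ⟨Function.update a r w, u, v, cn, [], cs, [], [], ct, []⟩ (flips cs.length T) := by
  refine (acts_load (t := t + 5 * cn.length + 8 * cs.length + 6) cn [] [] w ?_).mono (by omega)
  rw [show afterLoad b f r q i = (.goto (.phase (.salt i) b f r q) : Prog M U V) by
    cases i <;> simp_all [afterLoad]]
  refine .goto ((acts_salt (t := t + 5 * cn.length + 3 * cs.length + 4) cs [] _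
    fun x hx => .goto ?_).mono (by omega))
  refine (acts_unsalt (t := t + 5 * cn.length + 2) (cs.reverse ++ []) [] (.goto ?_)).mono
    (by simp; omega)
  refine (acts_unload (t := t) _ _ [] _ (by simp) ?_).mono (by simp)
  simpa using h x hx

theorem acts_read (hw : w.length ≤ cn.length + cs.length)
    (h : Acts M U V ℓ (block M U V (.sim b f q)) t
      ⟨Function.update a r (padTake cn.length w), u, v, cn, [], cs, [], [], ct, []⟩ T) :
    Acts M U V ℓ (block M U V (.phase (.load .dec) b f r q))
      (t + 12 * cn.length + 2 * cs.length + 6)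
      ⟨Function.update a r w, u, v, cn, [], cs, [], [], ct, []⟩ T := by
  refine (acts_load (t := t + 7 * cn.length + 2 * cs.length + 5) cn [] [] w ?_).mono (by omega)
  refine .goto ((acts_clear (t := t + 5 * cn.length + 3) _ ?_).mono
    (by simp only [List.length_drop]; omega))
  refine .goto ((acts_unload (t := t + 1) _ _ [] _ (by simp) (.goto ?_)).mono
    (by simp only [List.length_append, List.length_reverse, List.length_nil]; omega))
  simpa using h

theorem acts_refuse (hw : w.length ≤ cn.length + cs.length)
    (h : Acts M U V ℓ (block M U V (.sim b f q)) t
      ⟨Function.update a r [], u, v, cn, [], cs, [], [], ct, []⟩ T) :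
    Acts M U V ℓ (block M U V (.phase (.clear true) b f r q))
      (t + 2 * cn.length + 2 * cs.length + 2)
      ⟨Function.update a r w, u, v, cn, [], cs, [], [], ct, []⟩ T :=
  (acts_clear (t := t + 1) w (.goto h)).mono (by omega)

/-- The inverse is queried whether or not the ciphertext will be refused: both branches then start
from a word of at most `ℓ` bits, which keeps the erasing loop short. -/
theorem acts_decrypt (hct : ct.length ≤ cn.length + cs.length) {T : List Bool → QueryTree PermQuery}
    (h : ∀ y : List Bool, y.length ≤ cn.length → Acts M U V (cn.length + cs.length)
      (block M U V (.sim b f q)) t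
      ⟨Function.update a r y, u, v, cn, [], cs, [], [], ct, []⟩ (T y)) :
    Acts M U V (cn.length + cs.length) (block M U V (.phase (.cmp true) b f r q))
      (t + 22 * cn.length + 12 * cs.length + 12)
      ⟨Function.update a r w, u, v, cn, [], cs, [], [], ct, []⟩
      (.query .inv (padTake ct.length w ++ w.drop ct.length) fun y =>
        T (if padTake ct.length w = ct then [] else padTake cn.length y)) := by
  refine (acts_cmp (t := t + 17 * cn.length + 7 * cs.length + 10) ct [] [] w (.goto ?_)).mono
    (by omega)
  have := acts_uncmp (M := M) (U := U) (V := V) (ℓ := cn.length + cs.length)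
    (t := t + 12 * cn.length + 2 * cs.length + 7) (b := b) (f := f) (q := q) (r := r)
    (e := padTake ct.length w == ct) (a := a) (u := u) (v := v) (cn := cn) (cn' := []) (cs := cs)
    (cs' := []) (ct.reverse ++ []) ((padTake ct.length w).reverse ++ []) [] (w.drop ct.length)
    (by simp)
    (T := fun y => T (if padTake ct.length w = ct then [] else padTake cn.length y))
    fun y hy => .goto ?_
  · simpa using this.mono
      (t' := t + 17 * cn.length + 7 * cs.length + 9) (by simp; omega)
  · by_cases hc : padTake ct.length w = ct
    · simpa [hc] using (acts_refuse hy (h [] (by simp))).mono (by omega)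
    · simpa [hc] using (acts_read hy (h (padTake cn.length y) (by simp))).mono (by omega)

/-- Every step of the attacker is replaced by a number of steps linear in `n + s`, and the final `2`
pays for popping the guess and pushing the verdict. Between attacker steps the auxiliary stacks are
back in their rest position, which makes the induction on `t` work. -/
theorem acts_sim (n s : ℕ) (hn : cn.length = n) (hs : cs.length = s) (t : ℕ) (c : M.Cfg)
    (σ : Option (List Bool)) (hσ : ∀ x ∈ σ, x.length ≤ n + s)
    (h : M.HaltsWithin (max n (n + s)) (fun _ => True) t c) :
    Acts M U V (n + s) (block M U V (.sim b σ.isSome c.q)) (t * (30 * (n + s) + 30) + 2)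
      ⟨c.mem, u, v, cn, [], cs, [], [], σ.getD [], []⟩ ((M.tree t c).simulate n s b σ) := by
  subst hn hs
  have halts : ∀ (c : M.Cfg) (σ : Option (List Bool)) (t : ℕ), M.code c.q = .halt →
      Acts M U V (cn.length + cs.length) (simBlock b σ.isSome c.q) (t + 2)
      ⟨c.mem, u, v, cn, [], cs, [], [], σ.getD [], []⟩ (.ret (M.outBit c.mem == b)) := by
    intro c σ t hc
    rw [simBlock, hc]
    refine .pop (.push (.halt_of_eq ?_))
    simp only [Store.mem, Store.update_att, Store.update_tmp, List.head?_cons, OracleMachine.outBit,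
      Option.some.injEq, Bool.decide_eq_true]
    rfl
  induction t generalizing c σ with
  | zero => exact halts _ _ _ h.1
  | succ t ih =>
    -- The constant 30 is generous: the costliest case, the challenge with `b = true`, takes `24 n +
    -- 15 s + 18` steps.
    have hT : (t + 1) * (30 * (cn.length + cs.length) + 30) + 2 =
        t * (30 * (cn.length + cs.length) + 30) + 2 + 30 * (cn.length + cs.length) + 30 := by ring
    rw [hT]
    generalize t * (30 * (cn.length + cs.length) + 30) + 2 = t₀ at ih ⊢
    rw [OracleMachine.HaltsWithin] at h
    rw [OracleMachine.tree]
    simp only [block]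
    rcases hc : M.code c.q with _ | ⟨r, x, q⟩ | ⟨r, k⟩ | k | ⟨o, r, q⟩
    · exact (halts c σ 0 hc).mono (by omega)
    all_goals rw [hc] at h; rw [simBlock, hc]
    · refine Runs.mono (t := t₀ + 1 + 1) (.push (.goto ?_)) (by omega)
      simpa [Store.mem] using ih _ σ hσ h
    · refine Runs.mono (t := t₀ + 1 + 1) ?_ (by omega)
      refine .pop (.goto ?_)
      simpa [Store.mem] using ih _ σ hσ h
    · refine Runs.mono (t := t₀ + 1 + 1) ?_ (by omega)
      exact .flip fun x => .goto (ih ⟨k x, c.mem⟩ σ hσ (h x))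
    -- The loop lemmas expect the attacker's stacks in the form of an update at `r`.
    · have self : c.mem = Function.update c.mem r (c.mem r) := by simp
      have answer : ∀ (σ : Option (List Bool)), (∀ x ∈ σ, x.length ≤ cn.length + cs.length) →
          ∀ y : List Bool, y.length ≤ cn.length + cs.length →
          Acts M U V (cn.length + cs.length) (block M U V (.sim b σ.isSome q)) t₀
          ⟨Function.update c.mem r y, u, v, cn, [], cs, [], [], σ.getD [], []⟩
          ((M.tree t ⟨q, Function.update c.mem r y⟩).simulate cn.length cs.length b σ) :=
        fun σ hσ y hy => ih ⟨q, _⟩ σ hσ (h y (by omega))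
      cases o with
      | enc =>
        refine Runs.mono (t := t₀ + 2 + 10 * cn.length + 8 * cs.length + 7 + 1) (.goto ?_) (by omega)
        simp only
        rw [self]
        refine acts_write (by simp) fun x hx => .query_of_eq (by simp [Store.mem]) fun y hy => .goto ?_
        simpa using answer σ hσ y hy
      | dec =>
        cases σ with
        | none =>
          refine Runs.mono (t := t₀ + 12 * cn.length + 2 * cs.length + 6 + 1 + 1)
            (.query fun y hy => .goto ?_) (by omega)
          simpa using acts_read hy (answer none hσ (padTake cn.length y) (by simp))
        | some x =>
          refine Runs.mono (t := t₀ + 22 * cn.length + 12 * cs.length + 12 + 1) (.goto ?_) (by omega)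
          simp only
          rw [self]
          have := acts_decrypt (w := c.mem r) (hσ x rfl)
            (fun y hy => answer (some x) hσ y (by omega))
          simpa [simulate] using this
      | chal =>
        cases σ with
        | some x =>
          refine Runs.mono (t := t₀ + 2 * cn.length + 2 * cs.length + 2 + 1 + 1)
            (.query fun y hy => .goto ?_) (by omega)
          simpa using acts_refuse hy (answer (some x) hσ [] (by simp))
        | none =>
          have write : ∀ w, Acts M U V (cn.length + cs.length)
              (block M U V (.phase (.load .chal) b false r q))
              (t₀ + 17 * cn.length + 15 * cs.length + 13)
              ⟨Function.update c.mem r w, u, v, cn, [], cs, [], [], [], []⟩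
              (flips cs.length fun x => .query .fwd (padTake cn.length w ++ (x ++ w.drop cn.length))
                fun y => (M.tree t ⟨q, Function.update c.mem r y⟩).simulate cn.length cs.length b (some y)) := by
            intro w
            refine (acts_write (t := t₀ + 7 * cn.length + 7 * cs.length + 6) (by simp)
              fun x hx => .query_of_eq (by simp [Store.mem]) fun y hy => .goto ?_).mono (by omega)
            have := acts_copy (M := M) (U := U) (V := V) (ℓ := cn.length + cs.length) (f := false)
              (t := t₀ + 4 * y.length + 3) (b := b) (q := q) (r := r) (a := c.mem) (u := u) (v := v)
              (cn := cn) (cn' := []) (cs := cs) (cs' := []) (ct := []) (ct' := []) y []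
              (.goto ((acts_paste (t := t₀ + 1) _ _ [] (.goto ?_)).mono
                (by simp only [List.length_append, List.length_reverse, List.length_nil]; omega)))
              (T := (M.tree t ⟨q, Function.update c.mem r y⟩).simulate cn.length cs.length b (some y))
            · simpa using this.mono (by omega)
            · simpa using answer (some y) (by simpa using hy) y hy
          cases b with
          | false =>
            refine Runs.mono (t := t₀ + 17 * cn.length + 15 * cs.length + 13 + 1) (.goto ?_)
              (by omega)
            simpa [simulate] using write (c.mem r)
          | true =>
            refine Runs.mono (t := t₀ + 24 * cn.length + 15 * cs.length + 17 + 1) (.goto ?_)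
              (by omega)
            have := acts_skip (M := M) (U := U) (V := V) (ℓ := cn.length + cs.length) (f := false)
              (t := t₀ + 20 * cn.length + 15 * cs.length + 16) (b := true) (q := q) (r := r)
              (a := c.mem) (u := u) (v := v) (cs := cs) (cs' := []) (tmp := []) (ct := [])
              (ct' := []) cn [] (c.mem r) (.goto ((acts_unskip _ []
                (.goto (by simpa using write ((c.mem r).drop cn.length)))).mono
                (by simp only [List.length_append, List.length_reverse, List.length_nil]; omega)))
            simpa [simulate] using this.mono (by omega)

end Reduction

/-! ### Computing the lengths, starting up, and the polynomial time bound -/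

namespace Reduction

open Block QueryTree

variable {M : OracleMachine CCAQuery} {U V : OracleMachine Empty}
  {ℓ t : ℕ} {T : QueryTree PermQuery}
  {a : M.R → List Bool} {u : U.R → List Bool} {v : V.R → List Bool}
  {cn cs : List Bool}

/-- The final configuration may depend on the coins, but `h` gives the same tree `T` for every
configuration satisfying `post`, so the coins are noise. Each step of `W` costs its instruction and
a jump. -/
theorem runs_lengthBlock {R X : Type} [DecidableEq R] {B : X → Block PermQuery R X} {out : R}
    {W : OracleMachine Empty} {j : W.R → R} {x : W.Q → X} {y : X}
    (hB : ∀ q, B (x q) = lengthBlock j x y q) (m : (W.R → List Bool) → R → List Bool)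
    (hm : ∀ g r, m g (j r) = g r)
    (hu : ∀ g r l, Function.update (m g) (j r) l = m (Function.update g r l))
    {post : W.Cfg → Prop} {t' : ℕ} (h : ∀ c, post c → Runs B out ℓ (B y) t' (m c.mem) T)
    (t : ℕ) (c : W.Cfg) (hc : W.HaltsWithin 0 post t c) :
    Runs B out ℓ (B (x c.q)) (t' + 2 * t + 1) (m c.mem) T := by
  induction t generalizing c with
  | zero =>
    rw [hB, lengthBlock, hc.1]
    exact .goto (h c hc.2)
  | succ t ih =>
    rw [OracleMachine.HaltsWithin] at hc
    rw [hB, lengthBlock, show t' + 2 * (t + 1) + 1 = t' + 2 * t + 1 + 1 + 1 by ring]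
    rcases e : W.code c.q with _ | ⟨r, b, q⟩ | ⟨r, k⟩ | k | ⟨o, r, q⟩
    all_goals rw [e] at hc
    · exact (Runs.goto (h c hc)).mono (by omega)
    · refine .push (.goto ?_)
      rw [hu, hm]
      exact ih ⟨q, _⟩ hc
    · refine .pop (.goto ?_)
      rw [hu, hm]
      exact ih ⟨k _, _⟩ hc
    · exact .noise fun b => .goto (ih ⟨k b, _⟩ (hc b))
    · exact o.elim

theorem exists_length_le_of_haltsWithin {W : OracleMachine Empty} {post : W.Cfg → Prop} (t : ℕ)
    (c : W.Cfg) (hc : W.HaltsWithin 0 post t c) :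
    ∃ c', post c' ∧ ∀ r, (c'.mem r).length ≤ (c.mem r).length + t := by
  induction t generalizing c with
  | zero => exact ⟨c, hc.2, fun r => le_rfl⟩
  | succ t ih =>
    rw [OracleMachine.HaltsWithin] at hc
    rcases e : W.code c.q with _ | ⟨r, b, q⟩ | ⟨r, k⟩ | k | ⟨o, r, q⟩
    all_goals rw [e] at hc
    · exact ⟨c, hc, fun r => by omega⟩
    · obtain ⟨c', h, h'⟩ := ih _ hc
      refine ⟨c', h, fun r' => (h' r').trans ?_⟩
      simp only [Function.update_apply]
      split_ifs with hr
      · subst hr; simp; omega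
      · omega
    · obtain ⟨c', h, h'⟩ := ih _ hc
      refine ⟨c', h, fun r' => (h' r').trans ?_⟩
      simp only [Function.update_apply]
      split_ifs with hr
      · subst hr; simp; omega
      · omega
    · obtain ⟨c', h, h'⟩ := ih _ (hc true)
      exact ⟨c', h, fun r' => (h' r').trans (by simp)⟩
    · exact o.elim

/-- A step pushes at most one bit, so along any single computation path the output is no longer than
input plus time. This bounds `n` and `s` by polynomials, without which the time of the distinguisher
would not be polynomial. -/
theorem length_le_of_haltsWithin {W : OracleMachine Empty} {κ t m : ℕ}
    (h : W.HaltsWithin 0 (fun c => (c.mem W.out).length = m) t (W.init κ)) : m ≤ κ + t := by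
  obtain ⟨c, rfl, hc⟩ := exists_length_le_of_haltsWithin t _ h
  refine (hc _).trans ?_
  simp only [OracleMachine.init, Function.update_apply]
  split_ifs <;> simp

theorem acts_moveN (l cn : List Bool)
    (h : ∀ u, Acts M U V ℓ (.goto (.runS V.start)) t
      ⟨a, u, v, l.reverse ++ cn, [], [], [], [], [], []⟩ T) :
    Acts M U V ℓ (block M U V .moveN) (t + 3 * l.length + 1)
      ⟨a, Function.update u U.out l, v, cn, [], [], [], [], [], []⟩ T := by
  induction l generalizing cn with
  | nil => exact .pop (by simpa [Store.mem] using h _)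
  | cons d l ih =>
    rw [show t + 3 * (d :: l).length + 1 = t + 3 * l.length + 1 + 1 + 1 + 1 by simp; ring]
    refine .pop ?_
    simp only [Store.mem, Store.update_lenN, Function.update_self, List.head?_cons, List.tail_cons]
    refine .push (.goto ?_)
    simpa [Store.mem] using ih (d :: cn) (by simpa using h)

theorem acts_moveS (l cs : List Bool) {T : Bool → QueryTree PermQuery}
    (h : ∀ b v, Acts M U V ℓ (block M U V (.sim b false M.start)) t
      ⟨a, u, v, cn, [], l.reverse ++ cs, [], [], [], []⟩ (T b)) :
    Acts M U V ℓ (block M U V .moveS) (t + 3 * l.length + 3)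
      ⟨a, u, Function.update v V.out l, cn, [], cs, [], [], [], []⟩ (.flip T) := by
  induction l generalizing cs with
  | nil =>
    refine .pop ?_
    simp only [Store.mem, Store.update_lenS, Function.update_self, List.head?_nil, List.tail_nil]
    exact .flip fun b => .goto (h b _)
  | cons d l ih =>
    rw [show t + 3 * (d :: l).length + 3 = t + 3 * l.length + 3 + 1 + 1 + 1 by simp; ring]
    refine .pop ?_
    simp only [Store.mem, Store.update_lenS, Function.update_self, List.head?_cons, List.tail_cons]
    refine .push (.goto ?_)
    simpa [Store.mem] using ih (d :: cs) (by simpa using h)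

theorem acts_copyInput (l x : List Bool)
    (h : Acts M U V ℓ (block M U V (.runN U.start)) t
      ⟨Function.update a M.inp (l.reverse ++ x), Function.update u U.inp (l.reverse ++ x),
        Function.update v V.inp (l.reverse ++ x), [], [], [], [], [], [], []⟩ T) :
    Acts M U V ℓ (block M U V .copyInput) (t + 5 * l.length + 2)
      ⟨Function.update a M.inp x, Function.update u U.inp x, Function.update v V.inp x,
        [], [], [], [], l, [], []⟩ T := by
  induction l generalizing x with
  | nil => exact .pop (.goto (by simpa [Store.mem] using h))
  | cons d l ih =>
    rw [show t + 5 * (d :: l).length + 2 = t + 5 * l.length + 2 + 1 + 1 + 1 + 1 + 1 by simp; ring]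
    refine .pop ?_
    simp only [Store.mem, Store.update_tmp, List.head?_cons, List.tail_cons]
    refine .push (.push (.push (.goto ?_)))
    simpa [Store.mem] using ih (d :: x) (by simpa using h)

theorem acts_start {κ n s p p' t : ℕ}
    (hU : U.HaltsWithin 0 (fun c => (c.mem U.out).length = n) p (U.init κ))
    (hV : V.HaltsWithin 0 (fun c => (c.mem V.out).length = s) p' (V.init κ))
    (hM : M.HaltsWithin (max n (n + s)) (fun _ => True) t (M.init κ)) :
    Acts M U V (n + s) (block M U V .copyInput)
      (t * (30 * (n + s) + 30) + 3 * n + 3 * s + 2 * p + 2 * p' + 5 * κ + 20)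
      ⟨fun _ => [], fun _ => [], fun _ => [], [], [], [], [], List.replicate κ true, [], []⟩
      (.flip fun b => (M.tree t (M.init κ)).simulate n s b none) := by
  have h₁ : ∀ u (cn : List Bool), cn.length = n → Acts M U V (n + s) (block M U V (.runS V.start))
      (t * (30 * (n + s) + 30) + 3 * s + 2 * p' + 6)
      ⟨(M.init κ).mem, u, (V.init κ).mem, cn, [], [], [], [], [], []⟩
      (.flip fun b => (M.tree t (M.init κ)).simulate n s b none) := by
    intro u cn hcn
    refine Runs.mono (t := t * (30 * (n + s) + 30) + 2 + 3 * s + 3 + 2 * p' + 1) ?_ (by omega)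
    refine runs_lengthBlock (B := block M U V) (j := .lenS) (x := .runS) (y := .moveS) (fun _ => rfl)
      (fun g => Store.mem ⟨(M.init κ).mem, u, g, cn, [], [], [], [], [], []⟩) (fun _ _ => rfl)
      (fun _ _ _ => by simp) (t' := t * (30 * (n + s) + 30) + 2 + 3 * s + 3) ?_ p' (V.init κ) hV
    intro c hc
    have := acts_moveS (M := M) (U := U) (V := V) (ℓ := n + s) (a := (M.init κ).mem) (u := u)
      (v := c.mem) (cn := cn) (t := t * (30 * (n + s) + 30) + 2) (c.mem V.out) []
      (T := fun b => (M.tree t (M.init κ)).simulate n s b none)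
      fun b v => acts_sim n s hcn (by simpa using hc) t (M.init κ) none (by simp) hM
    rw [hc] at this
    simpa using this
  have h₂ : Acts M U V (n + s) (block M U V (.runN U.start))
      (t * (30 * (n + s) + 30) + 3 * n + 3 * s + 2 * p + 2 * p' + 9)
      ⟨(M.init κ).mem, (U.init κ).mem, (V.init κ).mem, [], [], [], [], [], [], []⟩
      (.flip fun b => (M.tree t (M.init κ)).simulate n s b none) := by
    refine Runs.mono (t := t * (30 * (n + s) + 30) + 3 * s + 2 * p' + 6 + 1 + 3 * n + 1 + 2 * p + 1)
      ?_ (by omega)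
    refine runs_lengthBlock (B := block M U V) (j := .lenN) (x := .runN) (y := .moveN) (fun _ => rfl)
      (fun g => Store.mem ⟨(M.init κ).mem, g, (V.init κ).mem, [], [], [], [], [], [], []⟩)
      (fun _ _ => rfl) (fun _ _ _ => by simp)
      (t' := t * (30 * (n + s) + 30) + 3 * s + 2 * p' + 6 + 1 + 3 * n + 1) ?_ p (U.init κ) hU
    intro c hc
    have := acts_moveN (M := M) (U := U) (V := V) (ℓ := n + s) (a := (M.init κ).mem)
      (v := (V.init κ).mem) (u := c.mem) (c.mem U.out) []
      fun u => .goto (h₁ u _ (by simpa using hc))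
    rw [hc] at this
    simpa using this
  have := acts_copyInput (M := M) (U := U) (V := V) (a := fun _ => []) (u := fun _ => [])
    (v := fun _ => []) (List.replicate κ true) [] (by simpa [OracleMachine.init] using h₂)
    (T := .flip fun b => (M.tree t (M.init κ)).simulate n s b none)
  simpa using this.mono (by simp; omega)

/-- One machine serves all `π`, so the same `D` covers both the keyed and the uniform permutation.
-/
theorem exists_distinguisher {n s : ℕ → ℕ} (hn : PolyTimeLength n) (hs : PolyTimeLength s)
    (A : PolyAdversary CCAQuery fun κ => max (n κ) (n κ + s κ)) :
    ∃ D : PolyAdversary PermQuery fun κ => n κ + s κ,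
      ∀ κ (π : Equiv.Perm (Bits (n κ + s κ))), D.output κ (permOracle π) () =
        (PMF.uniformOfFintype Bool).bind fun b =>
          (A.output κ (permCCAOracle π b) none).map fun b' => b' == b := by
  obtain ⟨U, p, hU⟩ := hn
  obtain ⟨V, p', hV⟩ := hs
  -- This is the bound of `acts_start` with the lengths replaced by their upper bounds `κ + p κ` and
  -- `κ + p' κ`.
  let τ : Polynomial ℕ := A.time * (30 * ((.X + p) + (.X + p')) + 30) + 3 * (.X + p) +
    3 * (.X + p') + 2 * p + 2 * p' + 5 * .X + 20
  have hD : ∀ κ, Acts A.toOracleMachine U V (n κ + s κ) (block _ U V .copyInput) (τ.eval κ)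
      ⟨fun _ => [], fun _ => [], fun _ => [], [], [], [], [], List.replicate κ true, [], []⟩
      (.flip fun b => (A.tree (A.time.eval κ) (A.init κ)).simulate (n κ) (s κ) b none) := by
    intro κ
    refine (acts_start (hU κ) (hV κ) (A.halts κ)).mono ?_
    have h₁ := length_le_of_haltsWithin (hU κ)
    have h₂ := length_le_of_haltsWithin (hV κ)
    simp only [τ, Polynomial.eval_add, Polynomial.eval_mul, Polynomial.eval_X,
      Polynomial.eval_ofNat]
    gcongr
  have hinit : ∀ κ, (machine (block A.toOracleMachine U V) .copyInput .tmp .tmp).init κ =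
      ⟨label (block A.toOracleMachine U V) .copyInput .tmp .tmp .copyInput, Store.mem
      ⟨fun _ => [], fun _ => [], fun _ => [], [], [], [], [], List.replicate κ true, [], []⟩⟩ := by
    intro κ
    have : Function.update (fun _ : Stk A.R U.R V.R => ([] : List Bool)) .tmp
        (List.replicate κ true) = Store.mem
      ⟨fun _ => [], fun _ => [], fun _ => [], [], [], [], [], List.replicate κ true, [], []⟩ := by
      funext x; cases x <;> simp [Store.mem]
    rw [← this]
    rfl
  refine ⟨⟨machine (block A.toOracleMachine U V) .copyInput .tmp .tmp, τ, fun κ => ?_⟩,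
    fun κ π => ?_⟩
  · rw [hinit]
    exact (hD κ).haltsWithin .copyInput .tmp
  · rw [PolyAdversary.output_eq_eval_tree]
    simp only [hinit]
    rw [(hD κ).eval_tree .copyInput .tmp ?_ ()]
    · simp only [eval, PolyAdversary.output_eq_eval_tree]
      congr 1
      funext b
      exact eval_simulate π b _ none
    · rintro (_ | _) w _ x hx
      all_goals
        simp only [permOracle, PMF.support_pure, Set.mem_singleton_iff] at hx
        simp [hx]

end Reduction

/-! ### Permutations with prescribed values -/

section Extensions

variable {α : Type} [Fintype α] [DecidableEq α]

/-- The permutations with `π x = c` for all `(x, c)` in the list. -/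
def permExtensions (L : List (α × α)) : Finset (Equiv.Perm α) := {π | ∀ p ∈ L, π p.1 = p.2}

theorem mem_permExtensions {L : List (α × α)} {π : Equiv.Perm α} :
    π ∈ permExtensions L ↔ ∀ p ∈ L, π p.1 = p.2 := by
  simp [permExtensions]

theorem permExtensions_cons (L : List (α × α)) (x c : α) :
    permExtensions ((x, c) :: L) = {π ∈ permExtensions L | π x = c} := by
  ext π
  simp [mem_permExtensions, and_comm]

theorem permExtensions_cons' (L : List (α × α)) (x c : α) :
    permExtensions ((x, c) :: L) = {π ∈ permExtensions L | π.symm c = x} := by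
  refine (permExtensions_cons L x c).trans (Finset.filter_congr fun π _ => ?_)
  rw [Equiv.symm_apply_eq, eq_comm]

/-- The swap moves only points where nothing is prescribed. -/
theorem mul_swap_mem_permExtensions {L : List (α × α)} {x y : α} (hx : x ∉ L.map Prod.fst)
    (hy : y ∉ L.map Prod.fst) {π : Equiv.Perm α} (hπ : π ∈ permExtensions L) :
    π * Equiv.swap x y ∈ permExtensions L := by
  rw [mem_permExtensions] at *
  intro p hp
  have hp' := List.mem_map_of_mem (f := Prod.fst) hp
  rw [Equiv.Perm.mul_apply, Equiv.swap_apply_of_ne_of_ne (fun h => hx (by rwa [← h]))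
    (fun h => hy (by rwa [← h])), hπ p hp]

/-- A value that is not yet prescribed is taken at any given point with small probability. -/
theorem card_permExtensions_cons_mul_le (L : List (α × α)) (x c : α) (hx : x ∉ L.map Prod.fst) :
    (permExtensions ((x, c) :: L)).card * (Fintype.card α - L.length) ≤
      (permExtensions L).card := by
  -- By the swap, no free point `y` takes the value `c` less often than `x` does. Summing over the
  -- free points, and partitioning the extensions by the preimage of `c`, gives the bound.
  have hcard : ∀ y ∉ L.map Prod.fst,
      (permExtensions ((x, c) :: L)).card ≤ (permExtensions ((y, c) :: L)).card := by
    intro y hy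
    refine Finset.card_le_card_of_injOn (fun π => π * Equiv.swap x y) (fun π hπ => ?_)
      (fun π _ π' _ h => mul_right_cancel h)
    simp only [permExtensions_cons, Finset.coe_filter, Set.mem_ofPred_eq] at hπ ⊢
    exact ⟨mul_swap_mem_permExtensions hx hy hπ.1, by simp [hπ.2]⟩
  have hfree : Fintype.card α - L.length ≤ (Finset.univ \ (L.map Prod.fst).toFinset).card := by
    rw [Finset.card_sdiff_of_subset (Finset.subset_univ _), Finset.card_univ]
    have := (L.map Prod.fst).toFinset_card_le
    rw [List.length_map] at this
    omega
  calc _ ≤ (permExtensions ((x, c) :: L)).card *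
        (Finset.univ \ (L.map Prod.fst).toFinset).card := Nat.mul_le_mul_left _ hfree
    _ = ∑ y ∈ Finset.univ \ (L.map Prod.fst).toFinset, (permExtensions ((x, c) :: L)).card := by
        rw [Finset.sum_const, smul_eq_mul, mul_comm]
    _ ≤ ∑ y ∈ Finset.univ \ (L.map Prod.fst).toFinset, (permExtensions ((y, c) :: L)).card := by
        refine Finset.sum_le_sum fun y hy => hcard y ?_
        simpa using hy
    _ ≤ ∑ y, (permExtensions ((y, c) :: L)).card :=
        Finset.sum_le_sum_of_subset (Finset.subset_univ _)
    _ = (permExtensions L).card := by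
        simp only [permExtensions_cons']
        exact (Finset.card_eq_sum_card_fiberwise fun _ _ => Finset.mem_univ _).symm

end Extensions

/-! ### Averages -/

/-- Total expectation: a bound on every conditional mean, given the value of `h`, bounds the mean.
It is stated with sums, so that empty fibres need no separate treatment. -/
theorem abs_sum_le_of_fiberwise {ι β : Type} [Fintype β] [DecidableEq β] (s : Finset ι) (h : ι → β)
    (g : ι → ℝ) (B : ℝ) (H : ∀ y, |∑ i ∈ s with h i = y, g i| ≤ ({i ∈ s | h i = y} : Finset ι).card * B) :
    |∑ i ∈ s, g i| ≤ s.card * B := by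
  rw [← Finset.sum_fiberwise s h g,
    Finset.card_eq_sum_card_fiberwise (t := Finset.univ) (f := h) fun _ _ => Finset.mem_coe.2 (Finset.mem_univ _)]
  push_cast
  rw [Finset.sum_mul]
  exact (Finset.abs_sum_le_sum_abs _ _).trans (Finset.sum_le_sum fun y _ => H y)

/-- One exceptional fibre, of relative size at most `C`, is bounded trivially. In the application it
is the event that a decryption query hits the hidden point. -/
theorem abs_sum_le_of_fiberwise_ne {ι β : Type} [Fintype β] [DecidableEq β] (s : Finset ι)
    (h : ι → β) (g : ι → ℝ) (B C : ℝ) (hB : 0 ≤ B) (hg : ∀ i, |g i| ≤ 1) (y₀ : β)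
    (h₀ : ({i ∈ s | h i = y₀} : Finset ι).card ≤ s.card * C)
    (H : ∀ y ≠ y₀, |∑ i ∈ s with h i = y, g i| ≤ ({i ∈ s | h i = y} : Finset ι).card * B) :
    |∑ i ∈ s, g i| ≤ s.card * (B + C) := by
  have h₁ : |∑ i ∈ s, if h i = y₀ then 0 else g i| ≤ s.card * B := by
    refine abs_sum_le_of_fiberwise s h _ B fun y => ?_
    by_cases hy : y = y₀
    · subst hy
      rw [Finset.sum_eq_zero fun i hi => by simp [(Finset.mem_filter.1 hi).2], abs_zero]
      positivity
    · rw [Finset.sum_congr rfl (g := g) fun i hi =>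
        if_neg fun h' => hy ((Finset.mem_filter.1 hi).2.symm.trans h')]
      exact H y hy
  have h₂ : |∑ i ∈ s, if h i = y₀ then g i else 0| ≤ s.card * C := by
    rw [← Finset.sum_filter]
    refine (Finset.abs_sum_le_sum_abs _ _).trans ((Finset.sum_le_sum fun i _ => hg i).trans ?_)
    simpa using h₀
  have h₃ : ∑ i ∈ s, g i = (∑ i ∈ s, if h i = y₀ then 0 else g i) +
      ∑ i ∈ s, if h i = y₀ then g i else 0 := by
    rw [← Finset.sum_add_distrib]
    exact Finset.sum_congr rfl fun i _ => by split_ifs <;> simp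
  rw [h₃, mul_add]
  exact (abs_add_le _ _).trans (add_le_add h₁ h₂)

/-- Fresh randomness is independent of `i`, so the two sums can be exchanged; bad values of `u` are
bounded trivially. -/
theorem abs_sum_avg_le {ι U : Type} [Fintype U] [Nonempty U] [DecidableEq U] (s : Finset ι)
    (g : ι → U → ℝ) (B : ℝ) (hg : ∀ i u, |g i u| ≤ 1) (bad : Finset U) (hB : 0 ≤ B)
    (H : ∀ u ∉ bad, |∑ i ∈ s, g i u| ≤ s.card * B) :
    |∑ i ∈ s, (∑ u, g i u) / Fintype.card U| ≤ s.card * (B + bad.card / Fintype.card U) := by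
  have hU : (0 : ℝ) < Fintype.card U := by exact_mod_cast Fintype.card_pos
  have h : ∀ u, |∑ i ∈ s, g i u| ≤ s.card * B + if u ∈ bad then (s.card : ℝ) else 0 := by
    intro u
    split_ifs with hu
    · refine (Finset.abs_sum_le_sum_abs _ _).trans ((Finset.sum_le_sum fun i _ => hg i u).trans ?_)
      have : (0 : ℝ) ≤ s.card * B := by positivity
      simpa using this
    · simpa using H u hu
  rw [← Finset.sum_div, Finset.sum_comm, abs_div, abs_of_pos hU, div_le_iff₀ hU]
  refine (Finset.abs_sum_le_sum_abs _ _).trans ((Finset.sum_le_sum fun u _ => h u).trans ?_)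
  rw [Finset.sum_add_distrib, ← Finset.sum_filter]
  simp only [Finset.sum_const, Finset.card_univ, nsmul_eq_mul, Finset.filter_mem_eq_inter,
    Finset.univ_inter]
  field_simp
  exact le_refl _

theorem PMF.toReal_uniformOfFintype_bind_apply {α β : Type} [Fintype α] [Nonempty α]
    (f : α → PMF β) (b : β) : ((PMF.uniformOfFintype α).bind f b).toReal =
      (∑ a, (f a b).toReal) / Fintype.card α := by
  rw [PMF.bind_apply, tsum_fintype, ENNReal.toReal_sum fun a _ =>
    ENNReal.mul_ne_top (PMF.apply_ne_top _ _) (PMF.apply_ne_top _ _), Finset.sum_div]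
  refine Finset.sum_congr rfl fun a _ => ?_
  simp [ENNReal.toReal_mul, div_eq_inv_mul]

theorem PMF.toReal_apply_le_one {α : Type} (p : PMF α) (a : α) : (p a).toReal ≤ 1 :=
  ENNReal.toReal_le_of_le_ofReal zero_le_one (by simpa using p.coe_le_one a)

/-! ### The game with a random permutation -/

namespace QueryTree

/-- The tree asks at most `q` queries on every path. -/
inductive QueryBound {τ : Type} : QueryTree τ → ℕ → Prop
  | ret {x q} : QueryBound (ret x) q
  | flip {k q} : (∀ b, QueryBound (k b) q) → QueryBound (flip k) q
  | query {t w k q} : (∀ a, QueryBound (k a) q) → QueryBound (query t w k) (q + 1)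

theorem QueryBound.succ {τ : Type} {T : QueryTree τ} {q : ℕ} (h : T.QueryBound q) :
    T.QueryBound (q + 1) := by
  induction h with
  | ret => exact .ret
  | flip _ ih => exact .flip ih
  | query _ ih => exact .query ih

end QueryTree

/-- Each query costs a step, so the running time bounds the number of queries. -/
theorem OracleMachine.queryBound_tree {τ : Type} (M : OracleMachine τ) (t : ℕ) (c : M.Cfg) :
    (M.tree t c).QueryBound t := by
  induction t generalizing c with
  | zero => exact .ret
  | succ t ih =>
    rw [tree]
    split
    · exact .ret
    · exact (ih _).succ
    · exact (ih _).succ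
    · exact .flip fun b => (ih _).succ
    · exact .query fun a => ih _

open QueryTree

variable {n s : ℕ}

/-- The probability that the attacker outputs `1`. -/
noncomputable def outputProb (π : Equiv.Perm (Bits (n + s))) (b : Bool) (T : QueryTree CCAQuery)
    (σ : Option (Bits (n + s))) : ℝ :=
  (T.eval (permCCAOracle π b) σ true).toReal

theorem abs_outputProb_sub_le (π π' : Equiv.Perm (Bits (n + s))) (b b' : Bool)
    (T T' : QueryTree CCAQuery) (σ σ' : Option (Bits (n + s))) :
    |outputProb π b T σ - outputProb π' b' T' σ'| ≤ 1 :=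
  abs_sub_le_iff.2 ⟨by
    have := PMF.toReal_apply_le_one (T.eval (permCCAOracle π b) σ) true
    have : 0 ≤ outputProb π' b' T' σ' := ENNReal.toReal_nonneg
    unfold outputProb at *; linarith, by
    have := PMF.toReal_apply_le_one (T'.eval (permCCAOracle π' b') σ') true
    have : 0 ≤ outputProb π b T σ := ENNReal.toReal_nonneg
    unfold outputProb at *; linarith⟩

section OutputProb

variable (π : Equiv.Perm (Bits (n + s))) (b : Bool) (w : List Bool) (σ : Option (Bits (n + s)))
  (c : Bits (n + s))

theorem outputProb_flip (k : Bool → QueryTree CCAQuery) :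
    outputProb π b (.flip k) σ = (∑ x, outputProb π b (k x) σ) / Fintype.card Bool :=
  PMF.toReal_uniformOfFintype_bind_apply _ _

theorem outputProb_enc (k : List Bool → QueryTree CCAQuery) :
    outputProb π b (.query .enc w k) σ =
      (∑ u : Bits s, outputProb π b (k (π (Fin.append (Bits.ofList n w) u)).toList) σ) /
        Fintype.card (Bits s) := by
  rw [outputProb, eval, permCCAOracle, PMF.bind_map, PMF.toReal_uniformOfFintype_bind_apply]
  rfl

theorem outputProb_dec (k : List Bool → QueryTree CCAQuery) :
    outputProb π b (.query .dec w k) σ =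
      outputProb π b (k (if σ = some (Bits.ofList (n + s) w) then []
        else Bits.toList fun i : Fin n => π.symm (Bits.ofList (n + s) w) (Fin.castAdd s i))) σ := by
  simp [outputProb, eval, permCCAOracle]

theorem outputProb_chal_none (k : List Bool → QueryTree CCAQuery) :
    outputProb π b (.query .chal w k) none =
      (∑ u : Bits s, outputProb π b
          (k (π (Fin.append (Bits.ofList n (if b then w.drop n else w)) u)).toList)
          (some (π (Fin.append (Bits.ofList n (if b then w.drop n else w)) u)))) /
        Fintype.card (Bits s) := by
  rw [outputProb, eval, permCCAOracle, PMF.bind_map, PMF.toReal_uniformOfFintype_bind_apply]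
  rfl

theorem outputProb_chal_some (k : List Bool → QueryTree CCAQuery) :
    outputProb π b (.query .chal w k) (some c) = outputProb π b (k []) (some c) := by
  simp [outputProb, eval, permCCAOracle]

end OutputProb

/-- After the challenge the challenge bit does not matter. -/
theorem outputProb_some_eq (π : Equiv.Perm (Bits (n + s))) (b b' : Bool) (T : QueryTree CCAQuery)
    (c : Bits (n + s)) : outputProb π b T (some c) = outputProb π b' T (some c) := by
  induction T with
  | ret x => rfl
  | flip k ih => simp only [outputProb_flip, ih]
  | query o w k ih => cases o <;> simp only [outputProb_enc, outputProb_dec, outputProb_chal_some, ih]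

/-! ### Bad salts and the swapping argument -/

theorem append_injective (m : Bits n) : Function.Injective fun u : Bits s => Fin.append m u := by
  intro u v h
  funext i
  simpa using congrFun h (Fin.natAdd n i)

theorem card_filter_append_le (m : Bits n) (x y : Bits (n + s)) :
    ({u : Bits s | Fin.append m u = x ∨ Fin.append m u = y} : Finset (Bits s)).card ≤ 2 := by
  rw [← Finset.card_image_of_injective _ (append_injective m)]
  refine (Finset.card_le_card (t := {x, y}) ?_).trans Finset.card_le_two
  intro z
  simp only [Finset.mem_image, Finset.mem_filter]
  rintro ⟨u, ⟨-, h⟩, rfl⟩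
  simpa using h

/-- Either way the salt is the tail of a prescribed point. Both messages use the same `u`, so the
bound is `L.length` and not twice that. -/
theorem card_filter_append_mem_le (m m' : Bits n) (L : List (Bits (n + s) × Bits (n + s))) :
    ({u : Bits s | Fin.append m u ∈ L.map Prod.fst ∨ Fin.append m' u ∈ L.map Prod.fst} :
      Finset (Bits s)).card ≤ L.length := by
  have hsub : ({u : Bits s | Fin.append m u ∈ L.map Prod.fst ∨ Fin.append m' u ∈ L.map Prod.fst} :
      Finset (Bits s)) ⊆ (L.map fun p (i : Fin s) => p.1 (Fin.natAdd n i)).toFinset := by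
    intro u
    simp only [Finset.mem_filter, List.mem_map, List.mem_toFinset]
    rintro ⟨-, ⟨p, hp, h⟩ | ⟨p, hp, h⟩⟩ <;> exact ⟨p, hp, by funext i; simp [h]⟩
  exact (Finset.card_le_card hsub).trans ((List.toFinset_card_le _).trans (by simp))

theorem card_bits (n : ℕ) : Fintype.card (Bits n) = 2 ^ n := by simp

/-- The permutations `π` and `π ∘ (x₀ x₁)` can hardly be told apart after the challenge `π x₀`, if
nothing is known about `x₁`. -/
theorem abs_sum_outputProb_swap_le {Q : ℕ} (hQ : 2 * Q ≤ 2 ^ s) (b : Bool) {x₀ x₁ c₀ : Bits (n + s)}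
    {T : QueryTree CCAQuery} {q : ℕ} (hT : T.QueryBound q) (L : List (Bits (n + s) × Bits (n + s)))
    (hL : L.length + q ≤ Q) (h₀ : (x₀, c₀) ∈ L) (h₁ : x₁ ∉ L.map Prod.fst) :
    |∑ π ∈ permExtensions L, (outputProb (π * Equiv.swap x₀ x₁) b T (some c₀) -
      outputProb π b T (some c₀))| ≤ (permExtensions L).card * (q * (2 / 2 ^ s)) := by
  induction hT generalizing L with
  | ret =>
    simp only [outputProb, eval, sub_self, Finset.sum_const_zero, abs_zero]
    positivity
  | @flip k q _ ih =>
    simp only [outputProb_flip, ← sub_div, ← Finset.sum_sub_distrib]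
    have := abs_sum_avg_le (permExtensions L) (fun π x => outputProb (π * Equiv.swap x₀ x₁) b (k x) (some c₀) -
      outputProb π b (k x) (some c₀)) (q * (2 / 2 ^ s)) (fun _ _ => abs_outputProb_sub_le _ _ _ _ _ _ _ _)
      ∅ (by positivity) fun x _ => ih x L hL h₀ h₁
    simpa using this
  | @query o w k q _ ih =>
    have hq : ((q + 1 : ℕ) : ℝ) * (2 / 2 ^ s) = q * (2 / 2 ^ s) + 2 / 2 ^ s := by push_cast; ring
    have hpos : (0 : ℝ) ≤ 2 / 2 ^ s := by positivity
    have hmono : ∀ x : ℝ, x ≤ (permExtensions L).card * (q * (2 / 2 ^ s)) →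
        x ≤ (permExtensions L).card * ((q + 1 : ℕ) * (2 / 2 ^ s)) := fun x hx =>
      hx.trans (by rw [hq]; gcongr; linarith)
    cases o with
    | enc =>
      simp only [outputProb_enc, ← sub_div, ← Finset.sum_sub_distrib]
      rw [hq]
      refine (abs_sum_avg_le _ _ (q * (2 / 2 ^ s)) (fun _ _ => abs_outputProb_sub_le _ _ _ _ _ _ _ _)
        {u : Bits s | Fin.append (Bits.ofList n w) u = x₀ ∨ Fin.append (Bits.ofList n w) u = x₁}
        (by positivity) fun u hu => ?_).trans ?_
      · simp only [Finset.mem_filter, Finset.mem_univ, true_and, not_or] at hu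
        -- Away from `x₀` and `x₁` both permutations give the same ciphertext; conditioning on it
        -- adds one pair to `L`.
        refine abs_sum_le_of_fiberwise _ (fun π => π (Fin.append (Bits.ofList n w) u)) _ _ fun c => ?_
        rw [← permExtensions_cons, Finset.sum_congr rfl fun π hπ => by
          rw [Equiv.Perm.mul_apply, Equiv.swap_apply_of_ne_of_ne hu.1 hu.2,
            (mem_permExtensions.1 hπ) (_, c) List.mem_cons_self]]
        refine ih _ _ (by simp; omega) (List.mem_cons_of_mem _ h₀) ?_
        rw [List.map_cons, List.mem_cons, not_or]
        exact ⟨fun h => hu.2 h.symm, h₁⟩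
      · have : ((Finset.card {u : Bits s | Fin.append (Bits.ofList n w) u = x₀ ∨
            Fin.append (Bits.ofList n w) u = x₁} : ℕ) : ℝ) ≤ 2 := by
          exact_mod_cast card_filter_append_le (Bits.ofList n w) x₀ x₁
        rw [card_bits]
        push_cast
        gcongr
    | dec =>
      simp only [outputProb_dec, Option.some.injEq]
      split_ifs with hc
      · exact hmono _ (ih _ L (by omega) h₀ h₁)
      · rw [hq]
        -- Conditioning on the preimage under `π`; the exceptional fibre `x₁` is where the attacker
        -- can see the swap.
        refine abs_sum_le_of_fiberwise_ne _ (fun π => π.symm (Bits.ofList (n + s) w)) _ _ _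
          (by positivity) (fun _ => abs_outputProb_sub_le _ _ _ _ _ _ _ _) x₁ ?_ fun x hx => ?_
        · rw [← permExtensions_cons', mul_div_assoc', le_div_iff₀ (by positivity)]
          have h := card_permExtensions_cons_mul_le L x₁ (Bits.ofList (n + s) w) h₁
          -- Since `hQ` gives `|L| ≤ 2 ^ s / 2`, at least half of all blocks are still free.
          have h2 : 2 ^ s ≤ 2 * (Fintype.card (Bits (n + s)) - L.length) := by
            have : 2 ^ s ≤ 2 ^ (n + s) := Nat.pow_le_pow_right (by norm_num) (by omega)
            rw [card_bits]
            omega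
          have := (Nat.mul_le_mul_left (permExtensions ((x₁, Bits.ofList (n + s) w) :: L)).card h2).trans
            (show _ ≤ (permExtensions L).card * 2 by rw [mul_left_comm]; omega)
          exact_mod_cast this
        · rw [← permExtensions_cons']
          -- This fibre is empty: `L` prescribes `c₀` at `x₀`, and the queried ciphertext is not
          -- `c₀`.
          by_cases hx₀ : x = x₀
          · rw [Finset.sum_eq_zero, abs_zero]
            · positivity
            · intro π hπ
              rw [mem_permExtensions] at hπ
              have e₁ := hπ _ List.mem_cons_self
              have e₂ := hπ _ (List.mem_cons_of_mem _ h₀)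
              simp only at e₁ e₂
              exact absurd (e₂.symm.trans ((congrArg π hx₀.symm).trans e₁)) hc
          · rw [Finset.sum_congr rfl fun π hπ => by
              rw [show (π * Equiv.swap x₀ x₁).symm (Bits.ofList (n + s) w) = x by
                  rw [Equiv.symm_apply_eq, Equiv.Perm.mul_apply,
                    Equiv.swap_apply_of_ne_of_ne hx₀ hx,
                    (mem_permExtensions.1 hπ) (x, _) List.mem_cons_self],
                show π.symm (Bits.ofList (n + s) w) = x by
                  rw [Equiv.symm_apply_eq, (mem_permExtensions.1 hπ) (x, _) List.mem_cons_self]]]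
            refine ih _ _ (by simp; omega) (List.mem_cons_of_mem _ h₀) ?_
            rw [List.map_cons, List.mem_cons, not_or]
            exact ⟨fun h => hx h.symm, h₁⟩
    | chal =>
      simp only [outputProb_chal_some]
      exact hmono _ (ih _ L (by omega) h₀ h₁)

/-- Queries before the challenge only enlarge `L` and cost nothing. The term `Q / 2 ^ s` is paid
once, for a challenge salt that has already occurred; the other term pays for the queries after the
challenge. -/
theorem abs_sum_outputProb_le {Q : ℕ} (hQ : 2 * Q ≤ 2 ^ s)
    {T : QueryTree CCAQuery} {q : ℕ} (hT : T.QueryBound q) (L : List (Bits (n + s) × Bits (n + s)))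
    (hL : L.length + q ≤ Q) :
    |∑ π ∈ permExtensions L, (outputProb π true T none - outputProb π false T none)| ≤
      (permExtensions L).card * (q * (2 / 2 ^ s) + Q / 2 ^ s) := by
  induction hT generalizing L with
  | ret =>
    simp only [outputProb, eval, sub_self, Finset.sum_const_zero, abs_zero]
    positivity
  | @flip k q _ ih =>
    simp only [outputProb_flip, ← sub_div, ← Finset.sum_sub_distrib]
    have := abs_sum_avg_le (permExtensions L) (fun π x => outputProb π true (k x) none -
      outputProb π false (k x) none) (q * (2 / 2 ^ s) + Q / 2 ^ s)
      (fun _ _ => abs_outputProb_sub_le _ _ _ _ _ _ _ _) ∅ (by positivity) fun x _ => ih x L hL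
    simpa using this
  | @query o w k q hk ih =>
    have hmono : ∀ x : ℝ, x ≤ (permExtensions L).card * (q * (2 / 2 ^ s) + Q / 2 ^ s) →
        x ≤ (permExtensions L).card * ((q + 1 : ℕ) * (2 / 2 ^ s) + Q / 2 ^ s) := fun x hx =>
      hx.trans (by gcongr; omega)
    cases o with
    | enc =>
      simp only [outputProb_enc, ← sub_div, ← Finset.sum_sub_distrib]
      refine hmono _ ?_
      have := abs_sum_avg_le (permExtensions L) (fun π (u : Bits s) =>
        outputProb π true (k (π (Fin.append (Bits.ofList n w) u)).toList) none -
        outputProb π false (k (π (Fin.append (Bits.ofList n w) u)).toList) none)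
        (q * (2 / 2 ^ s) + Q / 2 ^ s)
        (fun _ _ => abs_outputProb_sub_le _ _ _ _ _ _ _ _) ∅ (by positivity) fun u _ => ?_
      · simpa using this
      · refine abs_sum_le_of_fiberwise _ (fun π => π (Fin.append (Bits.ofList n w) u)) _ _ fun c => ?_
        rw [← permExtensions_cons, Finset.sum_congr rfl fun π hπ => by
          rw [(mem_permExtensions.1 hπ) (_, c) List.mem_cons_self]]
        exact ih _ _ (by simp; omega)
    | dec =>
      simp only [outputProb_dec, reduceCtorEq, if_false]
      refine hmono _ (abs_sum_le_of_fiberwise _ (fun π => π.symm (Bits.ofList (n + s) w)) _ _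
        fun x => ?_)
      rw [← permExtensions_cons', Finset.sum_congr rfl fun π hπ => by
        rw [show π.symm (Bits.ofList (n + s) w) = x by
          rw [Equiv.symm_apply_eq, (mem_permExtensions.1 hπ) (x, _) List.mem_cons_self]]]
      exact ih _ _ (by simp; omega)
    | chal =>
      simp only [outputProb_chal_none, ← sub_div, ← Finset.sum_sub_distrib, if_true,
        Bool.false_eq_true, if_false]
      refine (abs_sum_avg_le _ _ (q * (2 / 2 ^ s)) (fun _ _ => abs_outputProb_sub_le _ _ _ _ _ _ _ _)
        {u : Bits s | Fin.append (Bits.ofList n w) u ∈ L.map Prod.fst ∨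
          Fin.append (Bits.ofList n (w.drop n)) u ∈ L.map Prod.fst}
        (by positivity) fun u hu => ?_).trans ?_
      · simp only [Finset.mem_filter, Finset.mem_univ, true_and, not_or] at hu
        obtain ⟨hu₀, hu₁⟩ := hu
        generalize Fin.append (Bits.ofList n w) u = x₀ at *
        generalize Fin.append (Bits.ofList n (w.drop n)) u = x₁ at *
        -- Reindexing by the swap turns the challenge `π x₁` into `π x₀`; by `outputProb_some_eq`
        -- the bit may then be replaced too.
        have hswap : ∑ π ∈ permExtensions L, outputProb π true (k (π x₁).toList) (some (π x₁)) =
            ∑ π ∈ permExtensions L,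
              outputProb (π * Equiv.swap x₀ x₁) false (k (π x₀).toList) (some (π x₀)) := by
          refine Finset.sum_bij' (fun π _ => π * Equiv.swap x₀ x₁) (fun π _ => π * Equiv.swap x₀ x₁)
            (fun π hπ => mul_swap_mem_permExtensions hu₀ hu₁ hπ)
            (fun π hπ => mul_swap_mem_permExtensions hu₀ hu₁ hπ) (by simp [mul_assoc])
            (by simp [mul_assoc]) fun π _ => ?_
          simp [mul_assoc, outputProb_some_eq π true false]
        rw [Finset.sum_sub_distrib, hswap, ← Finset.sum_sub_distrib]
        -- For equal messages the swap is the identity. This case is separate because `x₁` would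
        -- then be prescribed once `π x₀` is revealed.
        by_cases hx : x₀ = x₁
        · subst hx
          rw [Finset.sum_eq_zero fun π _ => by simp [← Equiv.Perm.one_def], abs_zero]
          positivity
        · refine abs_sum_le_of_fiberwise _ (fun π => π x₀) _ _ fun c => ?_
          rw [← permExtensions_cons, Finset.sum_congr rfl fun π hπ => by
            rw [show π x₀ = c from (mem_permExtensions.1 hπ) (x₀, c) List.mem_cons_self]]
          refine abs_sum_outputProb_swap_le hQ false (hk _) _ (by simp; omega) List.mem_cons_self ?_
          rw [List.map_cons, List.mem_cons, not_or]
          exact ⟨fun h => hx h.symm, hu₁⟩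
      · have : ((Finset.card {u : Bits s | Fin.append (Bits.ofList n w) u ∈ L.map Prod.fst ∨
            Fin.append (Bits.ofList n (w.drop n)) u ∈ L.map Prod.fst} : ℕ) : ℝ) ≤ Q := by
          exact_mod_cast (card_filter_append_mem_le (Bits.ofList n w) (Bits.ofList n (w.drop n))
            L).trans (by omega)
        rw [card_bits]
        push_cast
        gcongr
        linarith

/-! ### From output probabilities to the advantage, and the conclusion -/

theorem PMF.toReal_map_beq_true (p : PMF Bool) (b : Bool) :
    (p.map (fun x => x == b) true).toReal =
      if b then (p true).toReal else 1 - (p true).toReal := by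
  have hsum : (p true).toReal + (p false).toReal = 1 := by
    rw [← ENNReal.toReal_add (p.apply_ne_top _) (p.apply_ne_top _), ← Fintype.sum_bool (fun x => p x),
      ← tsum_fintype (L := .unconditional _), p.tsum_coe, ENNReal.toReal_one]
  cases b <;> simp [PMF.map_apply, ← hsum]

/-- With a random permutation the attacker can hardly guess the challenge bit. -/
theorem abs_random_game_sub_half_le {n s : ℕ} {T : QueryTree CCAQuery} {Q : ℕ}
    (hT : T.QueryBound Q) :
    |(((PMF.uniformOfFintype (Equiv.Perm (Bits (n + s)))).bind fun π =>
      (PMF.uniformOfFintype Bool).bind fun b =>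
        (T.eval (permCCAOracle π b) none).map fun b' => b' == b) true).toReal - 1 / 2| ≤
      2 * (Q * (1 / 2) ^ s) := by
  -- Otherwise the claimed bound is at least 1 and there is nothing to prove.
  by_cases hQ : 2 * Q ≤ 2 ^ s
  · have h := abs_sum_outputProb_le (n := n) hQ hT [] (by simp)
    have huniv : permExtensions ([] : List (Bits (n + s) × Bits (n + s))) = Finset.univ := by
      ext π
      simp [mem_permExtensions]
    rw [huniv, Finset.card_univ] at h
    have hpos : (0 : ℝ) < Fintype.card (Equiv.Perm (Bits (n + s))) := by
      exact_mod_cast Fintype.card_pos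
    -- The bias is half the averaged difference of the two output probabilities.
    have hgame : (((PMF.uniformOfFintype (Equiv.Perm (Bits (n + s)))).bind fun π =>
        (PMF.uniformOfFintype Bool).bind fun b =>
          (T.eval (permCCAOracle π b) none).map fun b' => b' == b) true).toReal - 1 / 2 =
        (∑ π : Equiv.Perm (Bits (n + s)), (outputProb π true T none - outputProb π false T none)) /
          (2 * Fintype.card (Equiv.Perm (Bits (n + s)))) := by
      rw [PMF.toReal_uniformOfFintype_bind_apply]
      simp only [PMF.toReal_uniformOfFintype_bind_apply, PMF.toReal_map_beq_true, Fintype.sum_bool,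
        Fintype.card_bool, if_true, Bool.false_eq_true, if_false]
      rw [← Finset.sum_div, show (fun π : Equiv.Perm (Bits (n + s)) =>
        ((T.eval (permCCAOracle π true) none) true).toReal +
        (1 - ((T.eval (permCCAOracle π false) none) true).toReal)) = fun π =>
        1 + (outputProb π true T none - outputProb π false T none) by
          funext π; simp only [outputProb]; ring, Finset.sum_add_distrib]
      simp only [Finset.sum_const, Finset.card_univ, nsmul_eq_mul]
      field_simp
      push_cast
      ring
    rw [hgame, abs_div, abs_of_pos (by positivity : (0 : ℝ) < 2 * _), div_le_iff₀ (by positivity)]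
    refine h.trans ?_
    rw [one_div, inv_pow]
    have : (0 : ℝ) ≤ Fintype.card (Equiv.Perm (Bits (n + s))) * (Q * (2 ^ s)⁻¹) := by positivity
    -- The 3 comes from `Q * (2 / 2 ^ s) + Q / 2 ^ s`; the 4 is the constant 2 of the claim times
    -- the 2 of the halved bias.
    calc _ = 3 * ((Fintype.card (Equiv.Perm (Bits (n + s))) : ℝ) * (Q * (2 ^ s)⁻¹)) := by
          rw [div_eq_mul_inv, div_eq_mul_inv]; ring
      _ ≤ 4 * ((Fintype.card (Equiv.Perm (Bits (n + s))) : ℝ) * (Q * (2 ^ s)⁻¹)) := by linarith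
      _ = _ := by ring
  · have h1 : (1 : ℝ) ≤ 2 * (Q * (1 / 2) ^ s) := by
      rw [one_div, inv_pow, ← mul_assoc, ← div_eq_mul_inv, one_le_div (by positivity)]
      exact_mod_cast (not_le.1 hQ).le
    refine le_trans ?_ h1
    generalize (PMF.uniformOfFintype (Equiv.Perm (Bits (n + s)))).bind _ = p
    have h2 := p.toReal_apply_le_one true
    have h3 : 0 ≤ (p true).toReal := ENNReal.toReal_nonneg
    rw [abs_le]
    constructor <;> linarith

theorem mainTheorem3 (n s : ℕ → ℕ) (hn : PolyTimeLength n) (hs : PolyTimeLength s)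
    (hsalt : Negligible fun κ => (1 / 2 : ℝ) ^ s κ)
    (P : KeyedPerm fun κ => n κ + s κ) (hP : IsSPRP P) :
    IsCCASecure (seScheme n s P) := by
  intro A
  obtain ⟨D, hD⟩ := Reduction.exists_distinguisher hn hs A
  -- An exact equality, because `D` simulates the game perfectly for every permutation.
  have hreal : ∀ κ, ccaGame (seScheme n s P) A κ = sprpReal P D κ := by
    intro κ
    simp only [ccaGame, sprpReal, hD, ccaOracle_seScheme]
  have hideal : ∀ κ, |(sprpIdeal D κ true).toReal - 1 / 2| ≤
      2 * ((A.time.eval κ : ℕ) * (1 / 2) ^ s κ) := by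
    intro κ
    simp only [sprpIdeal, hD, PolyAdversary.output_eq_eval_tree]
    exact abs_random_game_sub_half_le (A.queryBound_tree _ _)
  have hpoly : Negligible fun κ => 2 * ((A.time.eval κ : ℕ) * (1 / 2 : ℝ) ^ s κ) := by
    have h := (hsalt.polynomial_mul (A.time.map (Nat.castRingHom ℝ))).const_mul 2
    refine h.congr fun κ => ?_
    have : (A.time.map (Nat.castRingHom ℝ)).eval (κ : ℝ) = (A.time.eval κ : ℕ) := by
      simp
    simp [this]
  refine Asymptotics.SuperpolynomialDecay.trans_abs_le ((hP D).add hpoly) fun κ => ?_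
  rw [hreal, abs_abs]
  refine le_trans ?_ (le_abs_self _)
  calc _ ≤ |(sprpReal P D κ true).toReal - (sprpIdeal D κ true).toReal| +
        |(sprpIdeal D κ true).toReal - 1 / 2| := abs_sub_le _ _ _
    _ ≤ _ := add_le_add le_rfl (hideal κ)
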